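/- For every $n\ge 1$ let $(X_1,Y_1),\dots,(X_n,Y_n)$ (the $n$-th problem, on a probability space that may depend on $n$) be i.i.d. pairs with covariates $X_i\in\mathbb R^{p_n}$ and responses $Y_i\in\{0,1\}$ that follow the logistic regression model $$P(Y_i=1\mid X_i)=\frac{e^{X_i^\top\beta_0(n)}}{1+e^{X_i^\top\beta_0(n)}},\qquad \beta_0(n)\in\mathbb R^{p_n}.$$ Let $J_0(n)=\{j:\beta_0(n)_j\neq 0\}$ and $\beta_{\min}(n)=\min_{j\in J_0(n)}|\beta_0(n)_j|$ (with $\min\emptyset=+\infty$). Let $\ell_n(\beta)=\sum_{i=1}^n\big(Y_iX_i^\top\beta-\log(1+e^{X_i^\top\beta})\big)$. For $J\subseteq[p_n]=\{1,\dots,p_n\}$ let $\hat\beta_J$ be a maximum likelihood estimator in the model $J$, that is, a maximizer of $\ell_n$ over the vectors $\beta\in\mathbb R^{p_n}$ that vanish outside $J$, and for $\gamma\in\mathbb R$ let $$\mathrm{BIC}_\gamma(J)=-2\,\ell_n(\hat\beta_J)+|J|\,\big(\log n+2\gamma\log p_n\big).$$ Let $q_n\ge1$ be integers. Suppose that $p_n\to\infty$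 and that there are constants $\kappa\in(0,\infty]$, $\tau\in(0,1)$, $0\le\psi<\frac13(1-\tau)$, $0\le\phi<1-\psi-\tau$ and $a_0,a_1,a_2,a_3>0$, none depending on $n$, such that for all sufficiently large $n$: * $p_n\le n^\kappa$ (no condition if $\kappa=\infty$), $\log p_n\le n^\tau$, $q_n\le n^\psi$, and $\beta_{\min}(n)\ge n^{-\phi/2}$; * $|J_0(n)|\le q_n$ and $\|\beta_0(n)\|_2\le a_0$; * for every unit vector $u\in\mathbb R^{p_n}$ with at most $2q_n$ non-zero entries, (A1) $E[(X_1^\top u)^2]\ge a_1$ and (A2) $E[|X_1^\top u|^3]\le a_2$; and (A3) $|X_{1j}|\le a_3$ almost surely for every $j\in[p_n]$. Then for every $\gamma>1-\frac1{2\kappa}$ (that is, $\gamma>1$ if $\kappa=\infty$), variable selection with $\mathrm{BIC}_\gamma$ is consistent: the probability of the event $$J_0(n)=\arg\min\{\mathrm{BIC}_\gamma(J): J\subseteq[p_n],\ |J|\le q_n\}$$ (the maximum likelihood estimators $\hat\beta_J$ exist for all $|J|\le q_n$, and $J_0(n)$ is the unique minimizer) tends to one as $n\to\infty$. -/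

import Mathlib

open Filter Topology MeasureTheory ProbabilityTheory
open scoped ENNReal

noncomputable section

/-- The support `{j : β j ≠ 0}` of a coefficient vector. -/
def coeffSupport {p : ℕ} (β : EuclideanSpace ℝ (Fin p)) : Finset (Fin p) :=
  Finset.univ.filter fun j => β j ≠ 0

/-- The logistic log-likelihood `∑ i, (y i * x iᵀ β - log (1 + exp (x iᵀ β)))`, conditional on
the covariates, for covariate vectors `x i` and responses `y i ∈ {0, 1}`. -/
def logisticLogLik {n p : ℕ} (x : Fin n → EuclideanSpace ℝ (Fin p)) (y : Fin n → ℝ)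
    (β : EuclideanSpace ℝ (Fin p)) : ℝ :=
  ∑ i, (y i * inner ℝ (x i) β - Real.log (1 + Real.exp (inner ℝ (x i) β)))

/-- `b` is a maximum likelihood estimator in the submodel given by `J`, whose parameter space
`ℝ^J` is identified with the vectors in `ℝ^p` that vanish outside of `J`. -/
def IsMLE {n p : ℕ} (x : Fin n → EuclideanSpace ℝ (Fin p)) (y : Fin n → ℝ)
    (J : Finset (Fin p)) (b : EuclideanSpace ℝ (Fin p)) : Prop :=
  coeffSupport b ⊆ J ∧
    ∀ β : EuclideanSpace ℝ (Fin p), coeffSupport β ⊆ J →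
      logisticLogLik x y β ≤ logisticLogLik x y b

/-- `BIC_γ(J) = -2 log L(b) + |J| (log n + 2 γ log p)`, to be evaluated at a maximum likelihood
estimator `b` of the model `J`; its value does not depend on which one. -/
def extendedBIC {n p : ℕ} (γ : ℝ) (x : Fin n → EuclideanSpace ℝ (Fin p)) (y : Fin n → ℝ)
    (J : Finset (Fin p)) (b : EuclideanSpace ℝ (Fin p)) : ℝ :=
  -2 * logisticLogLik x y b + (J.card : ℝ) * (Real.log n + 2 * γ * Real.log p)

/-- `J₀ = argmin {BIC_γ(J) : J ⊆ [p], |J| ≤ q}`: the maximum likelihood estimators of all the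
models `J` with `|J| ≤ q` exist, so that the scores are defined, and `J₀` is the unique minimizer
of the score among these models. -/
def IsBICArgmin {n p : ℕ} (γ : ℝ) (q : ℕ) (x : Fin n → EuclideanSpace ℝ (Fin p))
    (y : Fin n → ℝ) (J₀ : Finset (Fin p)) : Prop :=
  J₀.card ≤ q ∧
    ∃ b : Finset (Fin p) → EuclideanSpace ℝ (Fin p),
      (∀ J : Finset (Fin p), J.card ≤ q → IsMLE x y J (b J)) ∧
      ∀ J : Finset (Fin p), J.card ≤ q → J ≠ J₀ →
        extendedBIC γ x y J₀ (b J₀) < extendedBIC γ x y J (b J)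

/-- The pairs `(X i, Y i)` are independent and identically distributed, with `Y i ∈ {0, 1}`, and
given `X i` the conditional probability of `Y i = 1`, which is the conditional mean of `Y i`, has
log-odds `(X i)ᵀ β₀`, that is, equals `exp ((X i)ᵀ β₀) / (1 + exp ((X i)ᵀ β₀))`. -/
structure IsLogisticSample {Ω : Type*} [MeasurableSpace Ω] (μ : Measure Ω) {n p : ℕ}
    (X : Fin n → Ω → EuclideanSpace ℝ (Fin p)) (Y : Fin n → Ω → ℝ)
    (β₀ : EuclideanSpace ℝ (Fin p)) : Prop where
  measurable_covariate : ∀ i, Measurable (X i)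
  measurable_response : ∀ i, Measurable (Y i)
  binary : ∀ i ω, Y i ω = 0 ∨ Y i ω = 1
  indep : iIndepFun (fun i ω => (X i ω, Y i ω)) μ
  identDistrib : ∀ i j,
    IdentDistrib (fun ω => (X i ω, Y i ω)) (fun ω => (X j ω, Y j ω)) μ μ
  logistic : ∀ i,
    μ[Y i | MeasurableSpace.comap (X i) inferInstance]
      =ᵐ[μ] fun ω => Real.sigmoid (inner ℝ (X i ω) β₀)

/-- Moment and boundedness assumptions on the law of a random covariate vector `X`, with respect
to the sparsity level `q`. The entries of `X` are bounded, so the two integrals are finite. -/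
structure CovariateAssumptions {Ω : Type*} [MeasurableSpace Ω] (μ : Measure Ω) {p : ℕ}
    (X : Ω → EuclideanSpace ℝ (Fin p)) (q : ℕ) (a₁ a₂ a₃ : ℝ) : Prop where
  second_moment : ∀ u : EuclideanSpace ℝ (Fin p), ‖u‖ = 1 → (coeffSupport u).card ≤ q →
    a₁ ≤ ∫ ω, (inner ℝ (X ω) u) ^ 2 ∂μ
  third_moment : ∀ u : EuclideanSpace ℝ (Fin p), ‖u‖ = 1 → (coeffSupport u).card ≤ q →
    ∫ ω, |inner ℝ (X ω) u| ^ 3 ∂μ ≤ a₂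
  bounded : ∀ j : Fin p, ∀ᵐ ω ∂μ, |X ω j| ≤ a₃

end

/-!
Conditionally on the covariates, the log-likelihood `ℓ` of a logistic model is an exponential-family
likelihood, and near the true coefficient vector `β₀` it is quadratic up to third moments of the
covariates: `ℓ (β₀ + v) - ℓ β₀ = s v - F v / 2 + O (∑ i, |xᵢᵀ v| ^ 3)`, with score `s` and Fisher
information `F` (`abs_logisticLogLik_sub_quadLogRatio_le`).

*Design.* With high probability, the empirical second moments are bounded below and the empirical
third moments are bounded above, uniformly over vectors with at most `2 q` nonzero entries
(`measure_notMem_goodDesign_le`). The second moments follow from entrywise Hoeffding bounds, the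
third ones from a multiplicative Chernoff bound on nets of the unit balls of all models. Third
moments also show that few of the linear predictors `xᵢᵀ β₀` are large, so that `F` inherits the
lower bound (`fisherForm_ge_of_mem_goodDesign`). Moreover all coordinates of the score are of order
`√(n log p)` (`condResponseProb_score_coord_le`).

*Missing indices.* Concavity turns the local quadratic decay of `ℓ` into a global one. Hence maximum
likelihood estimators exist, those of models that contain the true one lie within
`O (√(q log p / n))` of `β₀`, and a model that misses an index of `β₀` loses a multiple of
`n ^ (1 - φ)` in likelihood, which exceeds all penalties (`IsRegularAt.logLik_add_le_of_le_norm`).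

*Superfluous indices.* For a model `J` that contains the true model and `k` more indices, the
log-likelihood ratio is, up to `o (log p)`, the difference of the suprema of `s v - F v / 2` over
the two models. This is half the squared norm of the projection of the standardized residuals to a
space of dimension at most `k`. The explicit moment generating function of the score and a net of
that space with `exp (O (k))` points give the sharp tail bound
`p ^ (-(1 + ε) k)` at the threshold `(1 + ε') k log p`
(`condResponseProb_supQuadLogRatio_le`). There are at most `p ^ k` such models, so a union bound
applies as soon as the penalty per index exceeds `2 log p` by a constant factor, which is what the
lower bound of `γ` provides (`exists_penalty_ge`).

Bounds that are conditional on the covariates are sums over `{0, 1}ⁿ`; they are transferred to the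
sample by `IsLogisticSample.measure_le_of_condResponseProb_le`.
-/

/-! ### The logistic cumulant function -/

/-- A function vanishing at `0` is bounded by `C * |h|` at `h` if its derivative is bounded by `C`
between `-|h|` and `|h|`. -/
lemma abs_le_mul_abs_of_abs_deriv_le {f f' : ℝ → ℝ} (hf : ∀ t, HasDerivAt f (f' t) t)
    (h0 : f 0 = 0) {h C : ℝ} (hC : ∀ t, |t| ≤ |h| → |f' t| ≤ C) : |f h| ≤ C * |h| := by
  have := (convex_Icc (-|h|) |h|).norm_image_sub_le_of_norm_hasDerivWithin_le
    (f := f) (f' := f') (C := C) (x := 0) (y := h)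
    (fun t _ => (hf t).hasDerivWithinAt) (fun t ht => hC t (abs_le.2 ht))
    (Set.mem_Icc.2 ⟨by simp, by simp⟩) (Set.mem_Icc.2 ⟨neg_abs_le h, le_abs_self h⟩)
  simpa [h0] using this

/-- The cumulant function `log (1 + exp t)` of the logistic model, whose derivative is the
sigmoid function. -/
noncomputable def logisticCumulant (t : ℝ) : ℝ := Real.log (1 + Real.exp t)

lemma hasDerivAt_logisticCumulant (t : ℝ) :
    HasDerivAt logisticCumulant (Real.sigmoid t) t := by
  have h1 : HasDerivAt (fun t => 1 + Real.exp t) (Real.exp t) t :=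
    (Real.hasDerivAt_exp t).const_add 1
  have h2 := h1.log (by positivity)
  convert! h2 using 1
  rw [Real.sigmoid_def, Real.exp_neg]
  have := Real.exp_pos t
  field_simp
  ring

lemma exp_logisticCumulant (t : ℝ) : Real.exp (logisticCumulant t) = 1 + Real.exp t :=
  Real.exp_log (by positivity)

/-- The derivative of the sigmoid function: the variance of a Bernoulli variable with log-odds
`t`. -/
noncomputable def sigmoidVar (t : ℝ) : ℝ := Real.sigmoid t * (1 - Real.sigmoid t)

lemma sigmoidVar_pos (t : ℝ) : 0 < sigmoidVar t :=
  mul_pos (Real.sigmoid_pos t) (by linarith [Real.sigmoid_lt_one t])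

lemma sigmoidVar_le_one (t : ℝ) : sigmoidVar t ≤ 1 := by
  have h0 := Real.sigmoid_pos t
  have h1 := Real.sigmoid_lt_one t
  unfold sigmoidVar
  nlinarith

lemma abs_sigmoid_sub_le (t h : ℝ) : |Real.sigmoid (t + h) - Real.sigmoid t| ≤ |h| := by
  have := abs_le_mul_abs_of_abs_deriv_le (f := fun h => Real.sigmoid (t + h) - Real.sigmoid t)
    (f' := fun h => sigmoidVar (t + h)) (h := h) (C := 1)
    (fun s => ((Real.hasDerivAt_sigmoid (t + s)).comp_const_add t s).sub_const _) (by simp)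
    (fun s _ => by rw [abs_of_pos (sigmoidVar_pos _)]; exact sigmoidVar_le_one _)
  simpa using this

lemma hasDerivAt_sigmoidVar (t : ℝ) :
    HasDerivAt sigmoidVar (sigmoidVar t * (1 - 2 * Real.sigmoid t)) t := by
  have h := Real.hasDerivAt_sigmoid t
  have := h.mul (h.const_sub 1)
  convert! this using 1
  unfold sigmoidVar
  ring

lemma abs_sigmoidVar_sub_le (t h : ℝ) : |sigmoidVar (t + h) - sigmoidVar t| ≤ |h| := by
  have := abs_le_mul_abs_of_abs_deriv_le (f := fun h => sigmoidVar (t + h) - sigmoidVar t)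
    (f' := fun h => sigmoidVar (t + h) * (1 - 2 * Real.sigmoid (t + h))) (h := h) (C := 1)
    (fun s => ((hasDerivAt_sigmoidVar (t + s)).comp_const_add t s).sub_const _) (by simp)
    (fun s _ => by
      rw [abs_mul, abs_of_pos (sigmoidVar_pos _)]
      refine mul_le_one₀ (sigmoidVar_le_one _) (abs_nonneg _) ?_
      rw [abs_le]
      constructor <;> linarith [Real.sigmoid_pos (t + s), Real.sigmoid_lt_one (t + s)])
  simpa using this

lemma abs_logisticCumulant_taylor_one (t h : ℝ) :
    |logisticCumulant (t + h) - logisticCumulant t - Real.sigmoid t * h| ≤ h ^ 2 := by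
  have := abs_le_mul_abs_of_abs_deriv_le
    (f := fun h => logisticCumulant (t + h) - logisticCumulant t - Real.sigmoid t * h)
    (f' := fun h => Real.sigmoid (t + h) - Real.sigmoid t) (h := h) (C := |h|)
    (fun s => by
      have h1 := (((hasDerivAt_logisticCumulant (t + s)).comp_const_add t s).sub_const
        (logisticCumulant t)).sub ((hasDerivAt_id s).const_mul (Real.sigmoid t))
      convert! h1 using 1
      simp) (by simp)
    (fun s hs => (abs_sigmoid_sub_le t s).trans hs)
  rwa [← pow_two, sq_abs] at this

lemma abs_logisticCumulant_taylor_two (t h : ℝ) :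
    |logisticCumulant (t + h) - logisticCumulant t - Real.sigmoid t * h
      - sigmoidVar t * h ^ 2 / 2| ≤ |h| ^ 3 := by
  have key : ∀ s, |s| ≤ |h| →
      |Real.sigmoid (t + s) - Real.sigmoid t - sigmoidVar t * s| ≤ |h| ^ 2 := by
    intro s hs
    have := abs_le_mul_abs_of_abs_deriv_le
      (f := fun h => Real.sigmoid (t + h) - Real.sigmoid t - sigmoidVar t * h)
      (f' := fun h => sigmoidVar (t + h) - sigmoidVar t) (h := s) (C := |s|)
      (fun u => by
        have h1 := (((Real.hasDerivAt_sigmoid (t + u)).comp_const_add t u).sub_const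
          (Real.sigmoid t)).sub ((hasDerivAt_id u).const_mul (sigmoidVar t))
        convert! h1 using 1
        simp [sigmoidVar]) (by simp)
      (fun u hu => (abs_sigmoidVar_sub_le t u).trans hu)
    refine this.trans ?_
    rw [pow_two]
    gcongr
  have := abs_le_mul_abs_of_abs_deriv_le
    (f := fun h => logisticCumulant (t + h) - logisticCumulant t - Real.sigmoid t * h
      - sigmoidVar t * h ^ 2 / 2)
    (f' := fun h => Real.sigmoid (t + h) - Real.sigmoid t - sigmoidVar t * h) (h := h)
    (C := |h| ^ 2)
    (fun s => by
      have h1 := (((hasDerivAt_logisticCumulant (t + s)).comp_const_add t s).sub_const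
        (logisticCumulant t)).sub ((hasDerivAt_id s).const_mul (Real.sigmoid t))
      have h2 := ((hasDerivAt_pow 2 s).const_mul (sigmoidVar t)).div_const 2
      convert! h1.sub h2 using 1
      simp
      ring) (by simp) key
  calc _ ≤ |h| ^ 2 * |h| := this
    _ = |h| ^ 3 := by ring

/-- The variance `sigmoidVar t` is bounded below on bounded sets; a set `{K < |t|}` is absorbed by
third moments, since `s ^ 2 * K ≤ s ^ 2 * |t| ≤ |s| ^ 3 + |t| ^ 3` there. -/
lemma sigmoidVar_mul_sq_ge {K : ℝ} (hK : 0 < K) (t s : ℝ) :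
    (1 + Real.exp K)⁻¹ ^ 2 * (s ^ 2 - (|s| ^ 3 + |t| ^ 3) / K) ≤ sigmoidVar t * s ^ 2 := by
  have hs := abs_nonneg s
  have ht := abs_nonneg t
  have hE := Real.exp_pos K
  rcases le_or_gt |t| K with h | h
  · have h1 : (1 + Real.exp K)⁻¹ ≤ Real.sigmoid t := by
      rw [Real.sigmoid_def]
      gcongr
      linarith [neg_abs_le t]
    have h2 : (1 + Real.exp K)⁻¹ ≤ 1 - Real.sigmoid t := by
      rw [← Real.sigmoid_neg, Real.sigmoid_def]
      gcongr
      linarith [le_abs_self t]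
    have h3 : (1 + Real.exp K)⁻¹ ^ 2 ≤ sigmoidVar t := by
      rw [pow_two]
      exact mul_le_mul h1 h2 (by positivity) (Real.sigmoid_nonneg t)
    have h4 : s ^ 2 - (|s| ^ 3 + |t| ^ 3) / K ≤ s ^ 2 := by
      have : 0 ≤ (|s| ^ 3 + |t| ^ 3) / K := by positivity
      linarith
    calc _ ≤ (1 + Real.exp K)⁻¹ ^ 2 * s ^ 2 := by gcongr
      _ ≤ _ := by gcongr
  · have h1 : s ^ 2 - (|s| ^ 3 + |t| ^ 3) / K ≤ 0 := by
      rw [sub_nonpos, le_div_iff₀ hK, ← sq_abs s]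
      have h2 : |s| ^ 2 * K ≤ |s| ^ 2 * |t| := by gcongr
      have h3 : |s| ^ 2 * |t| ≤ |s| ^ 3 + |t| ^ 3 := by
        rcases le_total |s| |t| with h | h
        · have : |s| ^ 2 * |t| ≤ |t| ^ 2 * |t| := by gcongr
          nlinarith [pow_nonneg hs 3]
        · have : |s| ^ 2 * |t| ≤ |s| ^ 2 * |s| := by gcongr
          nlinarith [pow_nonneg ht 3]
      linarith
    have h2 : 0 ≤ sigmoidVar t * s ^ 2 := mul_nonneg (sigmoidVar_pos t).le (sq_nonneg s)
    refine le_trans (mul_nonpos_of_nonneg_of_nonpos (by positivity) h1) h2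

/-! ### Score and Fisher information -/

section LogLik

variable {n p : ℕ} (x : Fin n → EuclideanSpace ℝ (Fin p)) (y : Fin n → ℝ)
  (β : EuclideanSpace ℝ (Fin p))

/-- The derivative of the logistic log-likelihood at `β` in direction `v`. -/
noncomputable def logisticScore (v : EuclideanSpace ℝ (Fin p)) : ℝ :=
  ∑ i, (y i - Real.sigmoid (inner ℝ (x i) β)) * inner ℝ (x i) v

/-- The Fisher information at `β`, conditional on the covariates, as a quadratic form: minus the
second derivative of the log-likelihood at `β` in direction `v`. -/
noncomputable def fisherForm (v : EuclideanSpace ℝ (Fin p)) : ℝ :=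
  ∑ i, sigmoidVar (inner ℝ (x i) β) * (inner ℝ (x i) v) ^ 2

/-- The quadratic approximation of the log-likelihood ratio `ℓ (β + v) - ℓ β`. -/
noncomputable def quadLogRatio (v : EuclideanSpace ℝ (Fin p)) : ℝ :=
  logisticScore x y β v - fisherForm x β v / 2

lemma logisticScore_smul (r : ℝ) (v : EuclideanSpace ℝ (Fin p)) :
    logisticScore x y β (r • v) = r * logisticScore x y β v := by
  simp only [logisticScore, inner_smul_right, Finset.mul_sum]
  exact Finset.sum_congr rfl fun i _ => by ring

lemma logisticLogLik_eq :
    logisticLogLik x y β = ∑ i, (y i * inner ℝ (x i) β - logisticCumulant (inner ℝ (x i) β)) :=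
  rfl

/-- The third-order Taylor remainder of the log-likelihood, which does not depend on the
responses. -/
lemma abs_logisticLogLik_sub_quadLogRatio_le (v : EuclideanSpace ℝ (Fin p)) :
    |logisticLogLik x y (β + v) - logisticLogLik x y β - quadLogRatio x y β v|
      ≤ ∑ i, |inner ℝ (x i) v| ^ 3 := by
  have : logisticLogLik x y (β + v) - logisticLogLik x y β - quadLogRatio x y β v
      = ∑ i, -(logisticCumulant (inner ℝ (x i) β + inner ℝ (x i) v)
        - logisticCumulant (inner ℝ (x i) β) - Real.sigmoid (inner ℝ (x i) β) * inner ℝ (x i) v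
        - sigmoidVar (inner ℝ (x i) β) * (inner ℝ (x i) v) ^ 2 / 2) := by
    simp only [logisticLogLik_eq, quadLogRatio, logisticScore, fisherForm, Finset.sum_div,
      ← Finset.sum_sub_distrib, inner_add_right]
    exact Finset.sum_congr rfl fun i _ => by ring
  rw [this]
  refine (Finset.abs_sum_le_sum_abs _ _).trans (Finset.sum_le_sum fun i _ => ?_)
  rw [abs_neg]
  exact abs_logisticCumulant_taylor_two _ _

lemma concaveOn_logisticLogLik : ConcaveOn ℝ Set.univ (logisticLogLik x y) := by
  have hb : ConvexOn ℝ Set.univ logisticCumulant := by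
    refine MonotoneOn.convexOn_of_deriv convex_univ ?_ ?_ ?_
    · exact (continuous_iff_continuousAt.2
        fun t => (hasDerivAt_logisticCumulant t).continuousAt).continuousOn
    · exact fun t _ => (hasDerivAt_logisticCumulant t).differentiableAt.differentiableWithinAt
    · intro s _ t _ hst
      rw [(hasDerivAt_logisticCumulant s).deriv, (hasDerivAt_logisticCumulant t).deriv]
      exact Real.sigmoid_monotone hst
  refine ⟨convex_univ, fun u _ v _ a b ha hb' hab => ?_⟩
  simp only [logisticLogLik_eq, smul_eq_mul, Finset.mul_sum, ← Finset.sum_add_distrib]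
  refine Finset.sum_le_sum fun i _ => ?_
  have := hb.2 (Set.mem_univ (inner ℝ (x i) u)) (Set.mem_univ (inner ℝ (x i) v)) ha hb' hab
  simp only [smul_eq_mul] at this
  rw [inner_add_right, inner_smul_right, inner_smul_right]
  linarith

lemma continuous_logisticLogLik : Continuous (logisticLogLik x y) := by
  unfold logisticLogLik
  refine continuous_finsetSum _ fun i _ => ?_
  have h : ∀ b : EuclideanSpace ℝ (Fin p), 1 + Real.exp (inner ℝ (x i) b) ≠ 0 :=
    fun b => by positivity
  exact Continuous.sub (by fun_prop) (Continuous.log (by fun_prop) h)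

/-- Third moments in direction `v` and of the linear predictors bound the contribution of the
observations with a large linear predictor, whose Fisher weight may be tiny. -/
lemma fisherForm_ge {c C K B : ℝ} (hK : 0 < K) (v : EuclideanSpace ℝ (Fin p))
    (hv : ‖v‖ = 1) (hc : c * n ≤ ∑ i, (inner ℝ (x i) v) ^ 2)
    (hC : ∑ i, |inner ℝ (x i) v| ^ 3 ≤ C * n) (hB : ∑ i, |inner ℝ (x i) β| ^ 3 ≤ B * n) :
    (1 + Real.exp K)⁻¹ ^ 2 * (c - (C + B) / K) * n * ‖v‖ ^ 2 ≤ fisherForm x β v := by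
  have h1 : ∑ i, (1 + Real.exp K)⁻¹ ^ 2 *
      ((inner ℝ (x i) v) ^ 2 - (|inner ℝ (x i) v| ^ 3 + |inner ℝ (x i) β| ^ 3) / K)
        ≤ fisherForm x β v :=
    Finset.sum_le_sum fun i _ => sigmoidVar_mul_sq_ge hK _ _
  refine le_trans ?_ h1
  rw [← Finset.mul_sum, Finset.sum_sub_distrib, ← Finset.sum_div, Finset.sum_add_distrib, hv,
    mul_assoc, mul_assoc]
  gcongr
  have : (∑ i, |inner ℝ (x i) v| ^ 3 + ∑ i, |inner ℝ (x i) β| ^ 3) / K ≤ (C * n + B * n) / K := by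
    gcongr
  have e : (c - (C + B) / K) * (n * 1 ^ 2) = c * n - (C * n + B * n) / K := by ring
  linarith

end LogLik

/-! ### Nets of the unit ball -/

section Net

variable {E : Type*} [NormedAddCommGroup E] [NormedSpace ℝ E] [FiniteDimensional ℝ E]

/-- A volume comparison: balls of radius `η / 2` around the points are disjoint and contained in a
ball of radius `1 + η / 2`. -/
lemma card_le_pow_finrank_of_separated {η : ℝ} (hη : 0 < η) (s : Finset E)
    (hs : ∀ c ∈ s, ‖c‖ ≤ 1) (h : ∀ c ∈ s, ∀ d ∈ s, c ≠ d → η < ‖c - d‖) :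
    (s.card : ℝ) ≤ (1 + 2 / η) ^ Module.finrank ℝ E := by
  borelize E
  let μ : Measure E := Measure.addHaar
  have ρpos : 0 < 1 + η / 2 := by positivity
  have δpos : 0 < η / 2 := by positivity
  have D : Set.Pairwise (s : Set E)
      (Function.onFun Disjoint fun c => Metric.ball (c : E) (η / 2)) := by
    intro c hc d hd hcd
    apply Metric.ball_disjoint_ball
    rw [dist_eq_norm]
    linarith [h c hc d hd hcd]
  have hsub : (⋃ c ∈ s, Metric.ball (c : E) (η / 2)) ⊆ Metric.ball (0 : E) (1 + η / 2) := by
    refine Set.iUnion₂_subset fun c hc => Metric.ball_subset_ball' ?_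
    rw [dist_zero_right]
    linarith [hs c hc]
  have I : (s.card : ℝ≥0∞) * ENNReal.ofReal ((η / 2) ^ Module.finrank ℝ E) *
      μ (Metric.ball 0 1) ≤ ENNReal.ofReal ((1 + η / 2) ^ Module.finrank ℝ E) * μ (Metric.ball 0 1) := by
    rw [← μ.addHaar_ball_of_pos 0 ρpos]
    refine le_trans (le_of_eq ?_) (measure_mono hsub)
    rw [measure_biUnion_finset D fun c _ => measurableSet_ball]
    simp only [μ.addHaar_ball_of_pos _ δpos, Finset.sum_const, nsmul_eq_mul, mul_assoc]
  have J := (ENNReal.mul_le_mul_iff_left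
    (Metric.measure_ball_pos _ _ zero_lt_one).ne' measure_ball_lt_top.ne).1 I
  have K := ENNReal.toReal_le_of_le_ofReal (by positivity) J
  rw [ENNReal.toReal_mul, ENNReal.toReal_natCast, ENNReal.toReal_ofReal (by positivity)] at K
  have e : (1 : ℝ) + 2 / η = (1 + η / 2) / (η / 2)   := by
    field_simp
    ring
  rw [e, div_pow, le_div_iff₀ (by positivity)]
  exact K

/-- The unit ball of a `d`-dimensional space has an `η`-net of at most `(1 + 2 / η) ^ d` points. -/
lemma exists_finset_net_unitBall {η : ℝ} (hη : 0 < η) :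
    ∃ s : Finset E, (∀ c ∈ s, ‖c‖ ≤ 1) ∧ (∀ v : E, ‖v‖ ≤ 1 → ∃ c ∈ s, ‖v - c‖ ≤ η) ∧
      (s.card : ℝ) ≤ (1 + 2 / η) ^ Module.finrank ℝ E := by
  classical
  -- Otherwise every separated set can be enlarged, against the bound on its cardinality.
  by_contra! hcon
  have key : ∀ k : ℕ, ∃ s : Finset E, (∀ c ∈ s, ‖c‖ ≤ 1) ∧
      (∀ c ∈ s, ∀ d ∈ s, c ≠ d → η < ‖c - d‖) ∧ s.card = k := by
    intro k
    induction k with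
    | zero => exact ⟨∅, by simp, by simp, by simp⟩
    | succ k ih =>
      obtain ⟨s, hs1, hs2, hs3⟩ := ih
      have : ∃ v : E, ‖v‖ ≤ 1 ∧ ∀ c ∈ s, η < ‖v - c‖ := by
        by_contra! h
        exact (card_le_pow_finrank_of_separated hη s hs1 hs2).not_gt (hcon s hs1 h)
      obtain ⟨v, hv1, hv2⟩ := this
      have hv : v ∉ s := fun hv => by
        have := hv2 v hv
        simp at this
        linarith
      refine ⟨insert v s, ?_, ?_, by rw [Finset.card_insert_of_notMem hv, hs3]⟩
      · simp only [Finset.mem_insert, forall_eq_or_imp]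
        exact ⟨hv1, hs1⟩
      · intro c hc d hd hcd
        rcases Finset.mem_insert.1 hc with rfl | hc' <;> rcases Finset.mem_insert.1 hd with rfl | hd'
        · exact absurd rfl hcd
        · exact hv2 d hd'
        · rw [norm_sub_rev]
          exact hv2 c hc'
        · exact hs2 c hc' d hd' hcd
  obtain ⟨k, hk⟩ := exists_nat_gt ((1 + 2 / η) ^ Module.finrank ℝ E)
  obtain ⟨s, hs1, hs2, rfl⟩ := key k
  exact (card_le_pow_finrank_of_separated hη s hs1 hs2).not_gt hk

end Net

/-- A large value of `⟪ε, w⟫ - ‖w‖ ^ 2 / 2` on a subspace is witnessed by a large value of `⟪ε, g⟫`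
at a point `g` of a net of the unit ball: its supremum is half the squared norm of the projection
of `ε`, and `g` is taken close to the direction of that projection. -/
lemma exists_mem_net_lt_inner {F : Type*} [NormedAddCommGroup F] [InnerProductSpace ℝ F]
    (U : Submodule ℝ F) [FiniteDimensional ℝ U] {N : Finset U} {η T : ℝ} (hη : η < 1)
    (hN : ∀ v : U, ‖v‖ ≤ 1 → ∃ c ∈ N, ‖v - c‖ ≤ η) {ε w : F} (hw : w ∈ U) (hT : 0 ≤ T)
    (h : T < inner ℝ ε w - ‖w‖ ^ 2 / 2) :
    ∃ g ∈ N, (1 - η) * √(2 * T) < inner ℝ ε (g : F) := by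
  set P : U := U.orthogonalProjectionOnto ε with hP
  have hin : ∀ g : U, inner ℝ ε (g : F) = inner ℝ P g := by
    intro g
    rw [hP, Submodule.inner_orthogonalProjectionOnto_eq_of_mem_right]
  have h1 : inner ℝ ε w ≤ ‖P‖ * ‖w‖ := by
    have := hin ⟨w, hw⟩
    simp only at this
    rw [this]
    exact real_inner_le_norm _ _
  have h2 : 2 * T < ‖P‖ ^ 2 := by nlinarith [sq_nonneg (‖P‖ - ‖w‖)]
  have h3 : √(2 * T) < ‖P‖ := by
    rw [Real.sqrt_lt' (by
      rcases (norm_nonneg P).eq_or_lt with h0 | h0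
      · rw [← h0] at h2
        norm_num at h2
        linarith
      · exact h0)]
    exact h2
  have hP0 : 0 < ‖P‖ := (Real.sqrt_nonneg _).trans_lt h3
  obtain ⟨g, hg, hgN⟩ := hN (‖P‖⁻¹ • P) (by
    rw [norm_smul, norm_inv, norm_norm, inv_mul_cancel₀ hP0.ne'])
  refine ⟨g, hg, ?_⟩
  rw [hin]
  have e : inner ℝ P g = ‖P‖ - inner ℝ P (‖P‖⁻¹ • P - g) := by
    rw [inner_sub_right, inner_smul_right, real_inner_self_eq_norm_sq]
    field_simp
    ring
  have h4 : inner ℝ P (‖P‖⁻¹ • P - g) ≤ ‖P‖ * η :=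
    (real_inner_le_norm _ _).trans (by gcongr)
  have h5 : (1 - η) * √(2 * T) < (1 - η) * ‖P‖ := by
    apply mul_lt_mul_of_pos_left h3
    linarith
  rw [e]
  linarith

/-! ### Sparse vectors -/

/-- The vectors that vanish outside of `J`. -/
def sparseSubmodule {p : ℕ} (J : Finset (Fin p)) : Submodule ℝ (EuclideanSpace ℝ (Fin p)) where
  carrier := {v | coeffSupport v ⊆ J}
  add_mem' := by
    intro a b ha hb j hj
    by_contra h
    have h1 : a j = 0 := by
      by_contra h'
      exact h (ha (by simpa [coeffSupport] using h'))
    have h2 : b j = 0 := by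
      by_contra h'
      exact h (hb (by simpa [coeffSupport] using h'))
    exact (Finset.mem_filter.1 hj).2 (by simp [h1, h2])
  zero_mem' := by
    intro j hj
    simp [coeffSupport] at hj
  smul_mem' := by
    intro c v hv j hj
    refine hv ?_
    simp only [coeffSupport, Finset.mem_filter, Finset.mem_univ, true_and] at hj ⊢
    intro h
    simp [h] at hj

section Sparse

variable {p : ℕ}

lemma mem_sparseSubmodule {J : Finset (Fin p)} {v : EuclideanSpace ℝ (Fin p)} :
    v ∈ sparseSubmodule J ↔ coeffSupport v ⊆ J := Iff.rfl

lemma mem_sparseSubmodule' {J : Finset (Fin p)} {v : EuclideanSpace ℝ (Fin p)} :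
    v ∈ sparseSubmodule J ↔ ∀ j, j ∉ J → v j = 0 := by
  rw [mem_sparseSubmodule]
  constructor
  · intro h j hj
    by_contra h'
    exact hj (h (by simpa [coeffSupport] using h'))
  · intro h j hj
    by_contra h'
    simp [coeffSupport, h j h'] at hj

lemma sparseSubmodule_mono {I J : Finset (Fin p)} (h : I ⊆ J) :
    sparseSubmodule I ≤ sparseSubmodule J := fun _ hv => Finset.Subset.trans hv h

lemma mem_sparseSubmodule_coeffSupport (v : EuclideanSpace ℝ (Fin p)) :
    v ∈ sparseSubmodule (coeffSupport v) := Finset.Subset.refl _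

/-- The part of a vector with indices in `J`. -/
noncomputable def restrictCoeff (J : Finset (Fin p)) (v : EuclideanSpace ℝ (Fin p)) :
    EuclideanSpace ℝ (Fin p) :=
  WithLp.toLp 2 fun j => if j ∈ J then v j else 0

lemma restrictCoeff_apply (J : Finset (Fin p)) (v : EuclideanSpace ℝ (Fin p)) (j : Fin p) :
    restrictCoeff J v j = if j ∈ J then v j else 0 := rfl

lemma restrictCoeff_mem (J : Finset (Fin p)) (v : EuclideanSpace ℝ (Fin p)) :
    restrictCoeff J v ∈ sparseSubmodule J := by
  rw [mem_sparseSubmodule']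
  intro j hj
  simp [restrictCoeff_apply, hj]

lemma restrictCoeff_add_restrictCoeff_sdiff {I J : Finset (Fin p)}
    {v : EuclideanSpace ℝ (Fin p)} (hv : v ∈ sparseSubmodule J) :
    restrictCoeff I v + restrictCoeff (J \ I) v = v := by
  ext j
  rw [mem_sparseSubmodule'] at hv
  have := hv j
  simp only [PiLp.add_apply, restrictCoeff_apply, Finset.mem_sdiff]
  by_cases h1 : j ∈ I <;> by_cases h2 : j ∈ J <;> simp_all

lemma finrank_sparseSubmodule_le (J : Finset (Fin p)) :
    Module.finrank ℝ (sparseSubmodule J) ≤ J.card := by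
  classical
  have h : sparseSubmodule J ≤ Submodule.span ℝ
      ((J.image fun j => EuclideanSpace.single j (1 : ℝ) : Finset _) :
        Set (EuclideanSpace ℝ (Fin p))) := by
    intro v hv
    have hv' := mem_sparseSubmodule'.1 hv
    have e : v = ∑ j ∈ J, v j • EuclideanSpace.single j (1 : ℝ) := by
      ext i
      by_cases hi : i ∈ J
      · simp [WithLp.ofLp_sum, Finset.sum_apply, Pi.single_apply, hi]
      · simp [WithLp.ofLp_sum, Finset.sum_apply, Pi.single_apply, hi, hv' i hi]
    rw [e]
    refine Submodule.sum_mem _ fun j hj => Submodule.smul_mem _ _ (Submodule.subset_span ?_)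
    simp only [Finset.coe_image, Set.mem_image, Finset.mem_coe]
    exact ⟨j, hj, rfl⟩
  exact (Submodule.finrank_mono h).trans
    ((finrank_span_finset_le_card _).trans Finset.card_image_le)

lemma sum_abs_le_of_mem_sparseSubmodule {J : Finset (Fin p)} {v : EuclideanSpace ℝ (Fin p)}
    (hv : v ∈ sparseSubmodule J) : ∑ j, |v j| ≤ √J.card * ‖v‖ := by
  have hv' := mem_sparseSubmodule'.1 hv
  have e : ∑ j, |v j| = ∑ j ∈ J, |v j| := by
    refine (Finset.sum_subset (Finset.subset_univ J) fun j _ hj => ?_).symm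
    simp [hv' j hj]
  rw [e, ← Real.sqrt_sq (norm_nonneg v), ← Real.sqrt_mul (Nat.cast_nonneg _)]
  apply Real.le_sqrt_of_sq_le
  refine sq_sum_le_card_mul_sum_sq.trans ?_
  gcongr
  rw [EuclideanSpace.real_norm_sq_eq]
  simp only [sq_abs]
  exact Finset.sum_le_sum_of_subset_of_nonneg (Finset.subset_univ J) fun _ _ _ => sq_nonneg _

lemma abs_inner_le_of_mem_sparseSubmodule {J : Finset (Fin p)} {v : EuclideanSpace ℝ (Fin p)}
    (hv : v ∈ sparseSubmodule J) {x : EuclideanSpace ℝ (Fin p)} {A : ℝ} (hA : 0 ≤ A)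
    (hx : ∀ j, |x j| ≤ A) : |inner ℝ x v| ≤ A * (√J.card * ‖v‖) := by
  refine le_trans ?_ (mul_le_mul_of_nonneg_left (sum_abs_le_of_mem_sparseSubmodule hv) hA)
  rw [PiLp.inner_apply, Finset.mul_sum]
  refine (Finset.abs_sum_le_sum_abs _ _).trans (Finset.sum_le_sum fun j _ => ?_)
  simp only [RCLike.inner_apply, conj_trivial, abs_mul]
  rw [mul_comm]
  gcongr
  exact hx j

end Sparse

/-! ### Responses given the covariates -/

section Bernoulli

variable {n p : ℕ} (x : Fin n → EuclideanSpace ℝ (Fin p)) (β : EuclideanSpace ℝ (Fin p))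

/-- The response vector in `{0, 1}ⁿ` encoded by a vector of Booleans. -/
def boolResponse (b : Fin n → Bool) : Fin n → ℝ := fun i => if b i then 1 else 0

/-- The conditional probability of the response `c` in the logistic model with log-odds `t`. -/
noncomputable def responseProb (t : ℝ) (c : Bool) : ℝ :=
  if c then Real.sigmoid t else 1 - Real.sigmoid t

/-- The conditional probability of the response vector `b` given the covariates `x`. -/
noncomputable def responseWeight (b : Fin n → Bool) : ℝ :=
  ∏ i, responseProb (inner ℝ (x i) β) (b i)

lemma responseProb_nonneg (t : ℝ) (c : Bool) : 0 ≤ responseProb t c := by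
  unfold responseProb
  split_ifs
  · exact Real.sigmoid_nonneg t
  · linarith [Real.sigmoid_le_one t]

lemma responseWeight_nonneg (b : Fin n → Bool) : 0 ≤ responseWeight x β b :=
  Finset.prod_nonneg fun _ _ => responseProb_nonneg _ _

open Classical in
/-- The conditional probability of a set of response vectors given the covariates `x`. -/
noncomputable def condResponseProb (S : Set (Fin n → Bool)) : ℝ :=
  ∑ b, if b ∈ S then responseWeight x β b else 0

lemma sum_responseProb_mul_exp (t h : ℝ) :
    ∑ c : Bool, responseProb t c * Real.exp (((if c then 1 else 0) - Real.sigmoid t) * h)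
      = Real.exp (logisticCumulant (t + h) - logisticCumulant t - Real.sigmoid t * h) := by
  have e1 : Real.sigmoid t = Real.exp t / (1 + Real.exp t) := by
    rw [Real.sigmoid_def, Real.exp_neg]
    have := Real.exp_pos t
    field_simp
    ring
  have e2 : 1 - Real.sigmoid t = 1 / (1 + Real.exp t) := by
    rw [e1]
    have := Real.exp_pos t
    field_simp
    ring
  rw [Real.exp_sub, Real.exp_sub, exp_logisticCumulant, exp_logisticCumulant]
  simp only [Fintype.sum_bool, responseProb, if_true, Bool.false_eq_true, if_false]
  have e3 : Real.exp ((1 - Real.sigmoid t) * h) = Real.exp h / Real.exp (Real.sigmoid t * h) := by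
    rw [← Real.exp_sub]
    ring_nf
  have e4 : Real.exp ((0 - Real.sigmoid t) * h) = 1 / Real.exp (Real.sigmoid t * h) := by
    rw [one_div, ← Real.exp_neg]
    ring_nf
  rw [e3, e4, e2, e1, Real.exp_add]
  have := Real.exp_pos t
  have := Real.exp_pos (Real.exp t / (1 + Real.exp t) * h)
  field_simp
  ring

/-- The conditional moment generating function of the score. -/
lemma sum_responseWeight_mul_exp_score (v : EuclideanSpace ℝ (Fin p)) :
    ∑ b, responseWeight x β b * Real.exp (logisticScore x (boolResponse b) β v)
      = Real.exp (∑ i, (logisticCumulant (inner ℝ (x i) β + inner ℝ (x i) v)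
        - logisticCumulant (inner ℝ (x i) β)
        - Real.sigmoid (inner ℝ (x i) β) * inner ℝ (x i) v)) := by
  rw [Real.exp_sum]
  simp only [← sum_responseProb_mul_exp]
  rw [Finset.prod_univ_sum, Fintype.piFinset_univ]
  refine Finset.sum_congr rfl fun b _ => ?_
  rw [responseWeight, logisticScore, Real.exp_sum, ← Finset.prod_mul_distrib]
  rfl

lemma sum_responseWeight_mul_exp_score_le (v : EuclideanSpace ℝ (Fin p)) :
    ∑ b, responseWeight x β b * Real.exp (logisticScore x (boolResponse b) β v)
      ≤ Real.exp (∑ i, (inner ℝ (x i) v) ^ 2) := by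
  rw [sum_responseWeight_mul_exp_score]
  exact Real.exp_le_exp.2 (Finset.sum_le_sum fun i _ =>
    (le_abs_self _).trans (abs_logisticCumulant_taylor_one _ _))

lemma sum_responseWeight_mul_exp_score_le_fisher (v : EuclideanSpace ℝ (Fin p)) :
    ∑ b, responseWeight x β b * Real.exp (logisticScore x (boolResponse b) β v)
      ≤ Real.exp (fisherForm x β v / 2 + ∑ i, |inner ℝ (x i) v| ^ 3) := by
  rw [sum_responseWeight_mul_exp_score, fisherForm, Finset.sum_div, ← Finset.sum_add_distrib]
  refine Real.exp_le_exp.2 (Finset.sum_le_sum fun i _ => ?_)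
  have := (le_abs_self _).trans
    (abs_logisticCumulant_taylor_two (inner ℝ (x i) β) (inner ℝ (x i) v))
  linarith

/-- The union of Chernoff bounds for finitely many directions. -/
lemma condResponseProb_le_sum_chernoff {ι : Type*} (N : Finset ι)
    (v : ι → EuclideanSpace ℝ (Fin p)) (t : ℝ) {S : Set (Fin n → Bool)}
    (hS : ∀ b ∈ S, ∃ g ∈ N, t ≤ logisticScore x (boolResponse b) β (v g)) {M : ℝ}
    (hM : ∀ g ∈ N, ∑ b, responseWeight x β b * Real.exp (logisticScore x (boolResponse b) β (v g))
      ≤ Real.exp M) :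
    condResponseProb x β S ≤ N.card * Real.exp (M - t) := by
  classical
  calc condResponseProb x β S
      ≤ ∑ b, ∑ g ∈ N, responseWeight x β b *
          Real.exp (logisticScore x (boolResponse b) β (v g)) * Real.exp (-t) := by
        refine Finset.sum_le_sum fun b _ => ?_
        have hw := responseWeight_nonneg x β b
        split_ifs with hb
        · obtain ⟨g, hg, hgt⟩ := hS b hb
          refine le_trans ?_ (Finset.single_le_sum (f := fun g => responseWeight x β b *
            Real.exp (logisticScore x (boolResponse b) β (v g)) * Real.exp (-t))
            (fun g _ => by positivity) hg)
          simp only [mul_assoc, ← Real.exp_add]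
          exact le_mul_of_one_le_right hw (Real.one_le_exp (by linarith))
        · exact Finset.sum_nonneg fun g _ => by positivity
    _ = ∑ g ∈ N, (∑ b, responseWeight x β b *
          Real.exp (logisticScore x (boolResponse b) β (v g))) * Real.exp (-t) := by
        rw [Finset.sum_comm]
        simp only [Finset.sum_mul]
    _ ≤ ∑ g ∈ N, Real.exp M * Real.exp (-t) :=
        Finset.sum_le_sum fun g hg => mul_le_mul_of_nonneg_right (hM g hg) (Real.exp_pos _).le
    _ = N.card * Real.exp (M - t) := by
        rw [Finset.sum_const, nsmul_eq_mul, ← Real.exp_add, sub_eq_add_neg]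

/-- The coordinates of the score are uniformly of order `√(n log p)`. -/
lemma condResponseProb_score_coord_le {A L : ℝ} (hn : 0 < n) (hA : 0 < A)
    (hx : ∀ i j, |x i j| ≤ A) (hL : 0 ≤ L) :
    condResponseProb x β
      {b | ∃ j, L < |logisticScore x (boolResponse b) β (EuclideanSpace.single j 1)|}
      ≤ 2 * p * Real.exp (-(L ^ 2 / (4 * n * A ^ 2))) := by
  have hn' : (0 : ℝ) < n := by exact_mod_cast hn
  -- The Chernoff exponent `l ^ 2 * n * A ^ 2 - l * L` is minimal at this `l`.
  set l : ℝ := L / (2 * n * A ^ 2) with hl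
  have hl0 : 0 ≤ l := by positivity
  have := condResponseProb_le_sum_chernoff x β (Finset.univ : Finset (Fin p × Bool))
    (fun g => ((if g.2 then l else -l) : ℝ) • EuclideanSpace.single g.1 (1 : ℝ)) (l * L)
    (S := {b | ∃ j, L < |logisticScore x (boolResponse b) β (EuclideanSpace.single j 1)|})
    (M := n * (l * A) ^ 2) ?_ ?_
  · refine this.trans (le_of_eq ?_)
    have e : (n : ℝ) * (l * A) ^ 2 - l * L = -(L ^ 2 / (4 * n * A ^ 2)) := by
      rw [hl]
      field_simp
      ring
    rw [e]
    simp
    ring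
  · rintro b ⟨j, hj⟩
    rcases lt_abs.1 hj with h | h
    · refine ⟨(j, true), Finset.mem_univ _, ?_⟩
      simp only [if_true, logisticScore_smul]
      gcongr
    · refine ⟨(j, false), Finset.mem_univ _, ?_⟩
      simp only [Bool.false_eq_true, if_false, logisticScore_smul, neg_mul, ← mul_neg]
      gcongr
  · rintro ⟨j, c⟩ _
    refine (sum_responseWeight_mul_exp_score_le x β _).trans (Real.exp_le_exp.2 ?_)
    have : ∀ i, (inner ℝ (x i) ((if c then l else -l : ℝ) • EuclideanSpace.single j (1 : ℝ))) ^ 2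
        ≤ (l * A) ^ 2 := by
      intro i
      rw [inner_smul_right, mul_pow, mul_pow, EuclideanSpace.inner_single_right]
      have h1 : (if c then l else -l : ℝ) ^ 2 = l ^ 2 := by cases c <;> simp
      rw [h1]
      have h2 : (x i j) ^ 2 ≤ A ^ 2 := sq_le_sq.2 ((hx i j).trans (le_abs_self A))
      simp only [one_mul, conj_trivial]
      gcongr
    calc _ ≤ ∑ _i : Fin n, (l * A) ^ 2 := Finset.sum_le_sum fun i _ => this i
      _ = _ := by simp

/-- The supremum over the model `J` of the quadratic approximation of the log-likelihood ratio at
`β`. It is nonnegative, being taken over a set that contains `0`. -/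
noncomputable def supQuadLogRatio (y : Fin n → ℝ) (J : Finset (Fin p)) : ℝ≥0∞ :=
  ⨆ v : sparseSubmodule J, ENNReal.ofReal (quadLogRatio x y β v)

/-- In a model `J ⊇ J₀` with `k` superfluous indices, the approximate log-likelihood ratio with
respect to `J₀` is half the squared norm of a projection of rank at most `k`; its conditional tail
is, up to a factor exponential in `k` and a third-order term, that of a chi-square variable. -/
lemma condResponseProb_supQuadLogRatio_le {J₀ J : Finset (Fin p)} (hJ : J₀ ⊆ J) {c C η T : ℝ}
    (hc : 0 < c) (hC : 0 ≤ C) (hη₀ : 0 < η) (hη₁ : η < 1) (hT : 0 ≤ T) (hn : 0 < n)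
    (hF : ∀ v ∈ sparseSubmodule J, c * n * ‖v‖ ^ 2 ≤ fisherForm x β v)
    (h3 : ∀ v ∈ sparseSubmodule J, ∑ i, |inner ℝ (x i) v| ^ 3 ≤ C * n * ‖v‖ ^ 3) :
    condResponseProb x β {b | supQuadLogRatio x β (boolResponse b) J₀ + ENNReal.ofReal T
        < supQuadLogRatio x β (boolResponse b) J}
      ≤ (1 + 2 / η) ^ (J \ J₀).card *
        Real.exp (C * n * ((1 - η) * √(2 * T) / √(c * n)) ^ 3 - ((1 - η) * √(2 * T)) ^ 2 / 2) := by
  have hn' : (0 : ℝ) < n := by exact_mod_cast hn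
  set l : ℝ := (1 - η) * √(2 * T) with hl
  have hl0 : 0 ≤ l := mul_nonneg (by linarith) (Real.sqrt_nonneg _)
  -- In the coordinates `A v`, the Fisher information is the Euclidean norm, and the score is
  -- the inner product with the vector `ε b` of standardized residuals.
  let A : EuclideanSpace ℝ (Fin p) →ₗ[ℝ] EuclideanSpace ℝ (Fin n) :=
    { toFun := fun v => WithLp.toLp 2 fun i => √(sigmoidVar (inner ℝ (x i) β)) * inner ℝ (x i) v
      map_add' := fun u v => by
        ext i
        simp [inner_add_right, mul_add]
      map_smul' := fun r v => by
        ext i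
        simp [inner_smul_right]
        ring }
  have hA : ∀ v i, A v i = √(sigmoidVar (inner ℝ (x i) β)) * inner ℝ (x i) v := fun _ _ => rfl
  let ε : (Fin n → Bool) → EuclideanSpace ℝ (Fin n) := fun b => WithLp.toLp 2 fun i =>
    (boolResponse b i - Real.sigmoid (inner ℝ (x i) β)) / √(sigmoidVar (inner ℝ (x i) β))
  have hAn : ∀ v, ‖A v‖ ^ 2 = fisherForm x β v := by
    intro v
    rw [EuclideanSpace.real_norm_sq_eq, fisherForm]
    refine Finset.sum_congr rfl fun i _ => ?_
    rw [hA, mul_pow, Real.sq_sqrt (sigmoidVar_pos _).le]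
  have hAs : ∀ b v, inner ℝ (ε b) (A v) = logisticScore x (boolResponse b) β v := by
    intro b v
    rw [PiLp.inner_apply, logisticScore]
    refine Finset.sum_congr rfl fun i _ => ?_
    simp only [RCLike.inner_apply, conj_trivial]
    have h0 := Real.sqrt_pos.2 (sigmoidVar_pos (inner ℝ (x i) β))
    rw [hA]
    simp only [ε]
    field_simp
  set V₀ := (sparseSubmodule J₀).map A with hV₀
  let R : EuclideanSpace ℝ (Fin n) →ₗ[ℝ] EuclideanSpace ℝ (Fin n) :=
    LinearMap.id - V₀.starProjection.toLinearMap
  have hR : ∀ z, R z = z - V₀.starProjection z := fun _ => rfl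
  set U := ((sparseSubmodule (J \ J₀)).map A).map R with hU
  have hUdim : Module.finrank ℝ U ≤ (J \ J₀).card :=
    (Submodule.finrank_map_le _ _).trans
      ((Submodule.finrank_map_le _ _).trans (finrank_sparseSubmodule_le _))
  have hproj : ∀ v, ∃ a ∈ sparseSubmodule J₀, A a = V₀.starProjection (A v) := by
    intro v
    have : V₀.starProjection (A v) ∈ V₀ := Submodule.starProjection_apply_mem _ _
    obtain ⟨a, ha, hav⟩ := this
    exact ⟨a, ha, hav⟩
  have hUA : ∀ g : U, ∃ v ∈ sparseSubmodule J, A v = g := by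
    rintro ⟨g, z, ⟨d, hd, rfl⟩, rfl⟩
    obtain ⟨a, ha, hav⟩ := hproj d
    refine ⟨d - a, Submodule.sub_mem _ (sparseSubmodule_mono Finset.sdiff_subset hd)
      (sparseSubmodule_mono hJ ha), ?_⟩
    simp only [map_sub, hav, hR]
  choose v hvJ hvA using hUA
  obtain ⟨N, hN1, hN2, hN3⟩ := exists_finset_net_unitBall (E := U) hη₀
  have hcard : (N.card : ℝ) ≤ (1 + 2 / η) ^ (J \ J₀).card := by
    refine hN3.trans (pow_le_pow_right₀ ?_ hUdim)
    have : 0 < 2 / η := by positivity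
    linarith
  have hmain := condResponseProb_le_sum_chernoff x β N (fun g => l • v g) (l ^ 2)
    (S := {b | supQuadLogRatio x β (boolResponse b) J₀ + ENNReal.ofReal T
        < supQuadLogRatio x β (boolResponse b) J})
    (M := C * n * (l / √(c * n)) ^ 3 + l ^ 2 / 2) ?_ ?_
  · refine hmain.trans ?_
    have e : C * n * (l / √(c * n)) ^ 3 + l ^ 2 / 2 - l ^ 2
      = C * n * (l / √(c * n)) ^ 3 - l ^ 2 / 2 := by ring
    rw [e]
    gcongr
  · intro b hb
    obtain ⟨⟨δ, hδ⟩, hlt⟩ := lt_iSup_iff.1 (show _ < ⨆ v : sparseSubmodule J,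
      ENNReal.ofReal (quadLogRatio x (boolResponse b) β v) from hb)
    simp only at hlt
    have hall : ∀ a ∈ sparseSubmodule J₀, quadLogRatio x (boolResponse b) β a + T
        < quadLogRatio x (boolResponse b) β δ := by
      intro a ha
      have h1 : ENNReal.ofReal (quadLogRatio x (boolResponse b) β a)
          ≤ supQuadLogRatio x β (boolResponse b) J₀ :=
        le_iSup (fun v : sparseSubmodule J₀ =>
          ENNReal.ofReal (quadLogRatio x (boolResponse b) β v)) ⟨a, ha⟩
      have h2 := (ENNReal.ofReal_add_le (p := quadLogRatio x (boolResponse b) β a) (q := T)).trans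
        (add_le_add_left h1 _)
      have h3 := h2.trans_lt hlt
      by_contra! h
      exact absurd (ENNReal.ofReal_le_ofReal h) (not_le.2 h3)
    have hQ : ∀ u, quadLogRatio x (boolResponse b) β u = inner ℝ (ε b) (A u) - ‖A u‖ ^ 2 / 2 := by
      intro u
      rw [quadLogRatio, hAs, hAn]
    obtain ⟨a, ha, hav⟩ := hproj δ
    have hw : A δ - A a ∈ U := by
      have e1 : A δ - A a = R (A δ) := by rw [hR, hav]
      have e2 : R (A (restrictCoeff J₀ δ)) = 0 := by
        rw [hR, sub_eq_zero]
        exact (Submodule.starProjection_eq_self_iff.2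
          (Submodule.mem_map_of_mem (restrictCoeff_mem J₀ δ))).symm
      rw [e1, ← restrictCoeff_add_restrictCoeff_sdiff (I := J₀) hδ, map_add, map_add, e2, zero_add]
      exact Submodule.mem_map_of_mem (Submodule.mem_map_of_mem (restrictCoeff_mem _ δ))
    have hgain : T < inner ℝ (ε b) (A δ - A a) - ‖A δ - A a‖ ^ 2 / 2 := by
      have h1 := hall a ha
      rw [hQ, hQ] at h1
      have horth : inner ℝ (A a) (A δ - A a) = 0 := by
        rw [hav]
        exact Submodule.inner_right_of_mem_orthogonal
          (Submodule.starProjection_apply_mem _ _) (Submodule.sub_starProjection_mem_orthogonal _)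
      have h2 : ‖A δ‖ ^ 2 = ‖A a‖ ^ 2 + ‖A δ - A a‖ ^ 2 := by
        have := norm_add_sq_real (A a) (A δ - A a)
        rw [horth] at this
        simpa using this
      rw [inner_sub_right]
      linarith
    obtain ⟨g, hg, hgl⟩ := exists_mem_net_lt_inner U hη₁ hN2 hw hT hgain
    refine ⟨g, hg, ?_⟩
    rw [logisticScore_smul, ← hAs, hvA, pow_two]
    exact mul_le_mul_of_nonneg_left hgl.le hl0
  · intro g hg
    refine (sum_responseWeight_mul_exp_score_le_fisher x β _).trans (Real.exp_le_exp.2 ?_)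
    have hg1 : fisherForm x β (v g) ≤ 1 := by
      rw [← hAn, hvA]
      have := hN1 g hg
      rw [Submodule.norm_coe]
      exact pow_le_one₀ (norm_nonneg _) this
    have h1 : fisherForm x β (l • v g) ≤ l ^ 2 := by
      rw [← hAn, map_smul, norm_smul, mul_pow, hAn, Real.norm_eq_abs, sq_abs]
      exact mul_le_of_le_one_right (sq_nonneg _) hg1
    have h2 : ‖v g‖ ≤ 1 / √(c * n) := by
      rw [le_div_iff₀ (by positivity)]
      have h3 : (‖v g‖ * √(c * n)) ^ 2 ≤ 1 := by
        rw [mul_pow, Real.sq_sqrt (by positivity), mul_comm]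
        exact (hF _ (hvJ g)).trans hg1
      exact (sq_le_one_iff₀ (by positivity)).1 h3
    have h3' := h3 _ (Submodule.smul_mem _ l (hvJ g))
    have h4 : ‖l • v g‖ ≤ l / √(c * n) := by
      rw [norm_smul, Real.norm_eq_abs, abs_of_nonneg hl0, div_eq_mul_one_div]
      gcongr
    have h5 : C * n * ‖l • v g‖ ^ 3 ≤ C * n * (l / √(c * n)) ^ 3 := by gcongr
    linarith

end Bernoulli

/-! ### The joint law of covariates and responses -/

section Sample

variable {Ω : Type*} [MeasurableSpace Ω] {μ : Measure Ω} {n p : ℕ}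
  {X : Fin n → Ω → EuclideanSpace ℝ (Fin p)} {Y : Fin n → Ω → ℝ}
  {β₀ : EuclideanSpace ℝ (Fin p)}

lemma measurable_responseProb (c : Bool) : Measurable fun t => responseProb t c := by
  have := continuous_sigmoid.measurable
  unfold responseProb
  cases c
  · simpa using this.const_sub 1
  · simpa using this

lemma IsLogisticSample.measurable_inner (h : IsLogisticSample μ X Y β₀) (i : Fin n)
    (v : EuclideanSpace ℝ (Fin p)) : Measurable fun ω => (inner ℝ (X i ω) v : ℝ) :=
  (continuous_id.inner continuous_const).measurable.comp (h.measurable_covariate i)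

/-- The joint law of one covariate vector and its response. -/
lemma IsLogisticSample.measure_inter [IsProbabilityMeasure μ]
    (h : IsLogisticSample μ X Y β₀) (i : Fin n) (c : Bool)
    {s : Set (EuclideanSpace ℝ (Fin p))} (hs : MeasurableSet s) :
    μ (X i ⁻¹' s ∩ Y i ⁻¹' {if c then 1 else 0})
      = ∫⁻ ω in X i ⁻¹' s, ENNReal.ofReal (responseProb (inner ℝ (X i ω) β₀) c) ∂μ := by
  have hX := h.measurable_covariate i
  have hY := h.measurable_response i
  have hYi : Integrable (Y i) μ := by
    refine Integrable.of_mem_Icc 0 1 hY.aemeasurable (ae_of_all _ fun ω => ?_)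
    rcases h.binary i ω with h | h <;> simp [h]
  have hσm : Measurable fun ω => Real.sigmoid (inner ℝ (X i ω) β₀) :=
    continuous_sigmoid.measurable.comp (h.measurable_inner i β₀)
  have hσi : Integrable (fun ω => Real.sigmoid (inner ℝ (X i ω) β₀)) μ :=
    Integrable.of_mem_Icc 0 1 hσm.aemeasurable
      (ae_of_all _ fun ω => ⟨Real.sigmoid_nonneg _, Real.sigmoid_le_one _⟩)
  have h1 : ∫ ω in X i ⁻¹' s, Y i ω ∂μ
      = ∫ ω in X i ⁻¹' s, Real.sigmoid (inner ℝ (X i ω) β₀) ∂μ := by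
    rw [← setIntegral_condExp hX.comap_le hYi ⟨s, hs, rfl⟩]
    exact setIntegral_congr_ae (hX hs) ((h.logistic i).mono fun ω hω _ => hω)
  have h2 : ∫ ω in X i ⁻¹' s, (Y i ⁻¹' {if c then 1 else 0}).indicator (fun _ => (1 : ℝ)) ω ∂μ
      = ∫ ω in X i ⁻¹' s, responseProb (inner ℝ (X i ω) β₀) c ∂μ := by
    cases c
    · have e : ∀ ω, (Y i ⁻¹' {if false then 1 else 0}).indicator (fun _ => (1 : ℝ)) ω
          = 1 - Y i ω := by
        intro ω
        rcases h.binary i ω with h | h <;> simp [Set.indicator, h]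
      rw [funext e]
      simp only [responseProb, Bool.false_eq_true, if_false]
      rw [integral_sub (integrable_const _) hYi.integrableOn,
        integral_sub (integrable_const _) hσi.integrableOn, h1]
    · have e : ∀ ω, (Y i ⁻¹' {if true then 1 else 0}).indicator (fun _ => (1 : ℝ)) ω
          = Y i ω := by
        intro ω
        rcases h.binary i ω with h | h <;> simp [Set.indicator, h]
      rw [funext e]
      simp only [responseProb, if_true]
      exact h1
  have hm : MeasurableSet (Y i ⁻¹' {if c then 1 else 0}) := hY (measurableSet_singleton _)
  rw [integral_indicator hm, setIntegral_const, smul_eq_mul, mul_one,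
    measureReal_restrict_apply hm] at h2
  rw [← ofReal_integral_eq_lintegral_ofReal, ← h2, Set.inter_comm, ofReal_measureReal]
  · refine Integrable.of_mem_Icc 0 1
      ((measurable_responseProb c).comp (h.measurable_inner i β₀)).aemeasurable
      (ae_of_all _ fun ω => ⟨responseProb_nonneg _ _, ?_⟩)
    unfold responseProb
    split_ifs
    · exact Real.sigmoid_le_one _
    · linarith [Real.sigmoid_nonneg (inner ℝ (X i ω) β₀)]
  · exact ae_of_all _ fun ω => responseProb_nonneg _ _

/-- The responses have conditional law `responseWeight` given all the covariates: both sides are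
product measures of the covariates, by independence. -/
lemma IsLogisticSample.measure_eq_lintegral_responseWeight [IsProbabilityMeasure μ]
    (h : IsLogisticSample μ X Y β₀)
    (b : Fin n → Bool) {A : Set (Fin n → EuclideanSpace ℝ (Fin p))} (hA : MeasurableSet A) :
    μ {ω | (fun i => X i ω) ∈ A ∧ (fun i => Y i ω) = boolResponse b}
      = ∫⁻ ω in {ω | (fun i => X i ω) ∈ A},
          ENNReal.ofReal (responseWeight (fun i => X i ω) β₀ b) ∂μ := by
  have hX : Measurable fun ω i => X i ω := measurable_pi_lambda _ h.measurable_covariate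
  have hw : ∀ i, Measurable fun x : EuclideanSpace ℝ (Fin p) =>
      ENNReal.ofReal (responseProb (inner ℝ x β₀) (b i)) := fun i =>
    ((measurable_responseProb (b i)).comp
      (continuous_id.inner continuous_const).measurable).ennreal_ofReal
  have hYm : ∀ i, MeasurableSet (Y i ⁻¹' {boolResponse b i}) := fun i =>
    h.measurable_response i (measurableSet_singleton _)
  have hYm' : MeasurableSet {ω | (fun i => Y i ω) = boolResponse b} := by
    have e : {ω | (fun i => Y i ω) = boolResponse b} = ⋂ i, Y i ⁻¹' {boolResponse b i} := by
      ext ω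
      simp [funext_iff]
    rw [e]
    exact MeasurableSet.iInter hYm
  let m : Fin n → Measure (EuclideanSpace ℝ (Fin p)) := fun i =>
    (μ.restrict (Y i ⁻¹' {boolResponse b i})).map (X i)
  have hm : ∀ i s, MeasurableSet s → m i s = μ (X i ⁻¹' s ∩ Y i ⁻¹' {boolResponse b i}) := by
    intro i s hs
    rw [Measure.map_apply (h.measurable_covariate i) hs,
      Measure.restrict_apply (h.measurable_covariate i hs)]
  have e1 : Measure.pi m
      = (μ.restrict {ω | (fun i => Y i ω) = boolResponse b}).map fun ω i => X i ω := by
    refine Measure.pi_eq fun s hs => ?_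
    rw [Measure.map_apply hX (MeasurableSet.univ_pi hs),
      Measure.restrict_apply (hX (MeasurableSet.univ_pi hs))]
    have := h.indep.measure_inter_preimage_eq_mul Finset.univ
      (sets := fun i => s i ×ˢ {boolResponse b i})
      (fun i _ => (hs i).prod (measurableSet_singleton _))
    simp only [hm _ _ (hs _)]
    refine Eq.trans (congrArg μ ?_) this
    ext ω
    simp [funext_iff, forall_and]
  have e2 : Measure.pi m = (μ.withDensity fun ω =>
      ENNReal.ofReal (responseWeight (fun i => X i ω) β₀ b)).map fun ω i => X i ω := by
    refine Measure.pi_eq fun s hs => ?_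
    rw [Measure.map_apply hX (MeasurableSet.univ_pi hs),
      withDensity_apply _ (hX (MeasurableSet.univ_pi hs)),
      ← lintegral_indicator (hX (MeasurableSet.univ_pi hs))]
    have hind : iIndepFun (fun i ω => (s i).indicator
        (fun x => ENNReal.ofReal (responseProb (inner ℝ x β₀) (b i))) (X i ω)) μ :=
      h.indep.comp (fun i z => (s i).indicator
        (fun x => ENNReal.ofReal (responseProb (inner ℝ x β₀) (b i))) z.1)
        (fun i => ((hw i).indicator (hs i)).comp measurable_fst)
    have hprod := lintegral_prod_eq_prod_lintegral_of_indepFun Finset.univ _ hind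
      (fun i => ((hw i).indicator (hs i)).comp (h.measurable_covariate i))
    refine Eq.trans (lintegral_congr fun ω => ?_) (hprod.trans ?_)
    · by_cases hω : ∀ i, X i ω ∈ s i
      · rw [Set.indicator_of_mem (by simpa using hω)]
        simp only [Set.indicator_of_mem (hω _)]
        rw [responseWeight, ENNReal.ofReal_prod_of_nonneg fun i _ => responseProb_nonneg _ _]
      · rw [Set.indicator_of_notMem (by simpa using hω)]
        push Not at hω
        obtain ⟨i, hi⟩ := hω
        exact (Finset.prod_eq_zero (Finset.mem_univ i) (Set.indicator_of_notMem hi _)).symm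
    · refine Finset.prod_congr rfl fun i _ => ?_
      rw [hm _ _ (hs i)]
      refine Eq.trans ?_ (h.measure_inter i (b i) (hs i)).symm
      rw [← lintegral_indicator (h.measurable_covariate i (hs i))]
      rfl
  have e3 := congrArg (fun ν : Measure (Fin n → EuclideanSpace ℝ (Fin p)) => ν A)
    (e1.symm.trans e2)
  rw [Measure.map_apply hX hA, Measure.map_apply hX hA, Measure.restrict_apply (hX hA),
    withDensity_apply _ (hX hA)] at e3
  exact e3

/-- A bound of conditional probabilities on a set of covariates yields an unconditional bound. -/
lemma IsLogisticSample.measure_le_of_condResponseProb_le [IsProbabilityMeasure μ]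
    (h : IsLogisticSample μ X Y β₀)
    {G : Set (Fin n → EuclideanSpace ℝ (Fin p))} (hG : MeasurableSet G)
    {S : (Fin n → EuclideanSpace ℝ (Fin p)) → Set (Fin n → Bool)}
    (hS : ∀ b, MeasurableSet {x | b ∈ S x}) {δ : ℝ}
    (hδ : ∀ x ∈ G, condResponseProb x β₀ (S x) ≤ δ) :
    μ {ω | (fun i => X i ω) ∈ G ∧
        ∃ b ∈ S (fun i => X i ω), (fun i => Y i ω) = boolResponse b} ≤ ENNReal.ofReal δ := by
  classical
  have hX : Measurable fun ω i => X i ω := measurable_pi_lambda _ h.measurable_covariate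
  have hw : ∀ b, Measurable fun ω => ENNReal.ofReal (responseWeight (fun i => X i ω) β₀ b) := by
    intro b
    refine Measurable.ennreal_ofReal ?_
    unfold responseWeight
    exact Finset.measurable_prod _ fun i _ =>
      (measurable_responseProb (b i)).comp (h.measurable_inner i β₀)
  have hsub : {ω | (fun i => X i ω) ∈ G ∧
        ∃ b ∈ S (fun i => X i ω), (fun i => Y i ω) = boolResponse b}
      ⊆ ⋃ b, {ω | (fun i => X i ω) ∈ G ∩ {x | b ∈ S x} ∧
          (fun i => Y i ω) = boolResponse b} := by
    rintro ω ⟨hω, b, hb, hY⟩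
    exact Set.mem_iUnion.2 ⟨b, ⟨hω, hb⟩, hY⟩
  have hmeas : ∀ b, MeasurableSet {ω | (fun i => X i ω) ∈ G ∩ {x | b ∈ S x}} :=
    fun b => hX (hG.inter (hS b))
  calc _ ≤ ∑ b, μ {ω | (fun i => X i ω) ∈ G ∩ {x | b ∈ S x} ∧
          (fun i => Y i ω) = boolResponse b} :=
        (measure_mono hsub).trans (measure_iUnion_fintype_le _ _)
    _ = ∑ b, ∫⁻ ω, {ω | (fun i => X i ω) ∈ G ∩ {x | b ∈ S x}}.indicator
          (fun ω => ENNReal.ofReal (responseWeight (fun i => X i ω) β₀ b)) ω ∂μ := by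
        refine Finset.sum_congr rfl fun b _ => ?_
        rw [h.measure_eq_lintegral_responseWeight b (hG.inter (hS b)),
          lintegral_indicator (hmeas b)]
    _ = ∫⁻ ω, ∑ b, {ω | (fun i => X i ω) ∈ G ∩ {x | b ∈ S x}}.indicator
          (fun ω => ENNReal.ofReal (responseWeight (fun i => X i ω) β₀ b)) ω ∂μ :=
        (lintegral_finsetSum _ fun b _ => (hw b).indicator (hmeas b)).symm
    _ ≤ ∫⁻ _, ENNReal.ofReal δ ∂μ := by
        refine lintegral_mono fun ω => ?_
        by_cases hω : (fun i => X i ω) ∈ G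
        · refine le_trans (le_of_eq ?_) (ENNReal.ofReal_le_ofReal (hδ _ hω))
          rw [condResponseProb, ENNReal.ofReal_sum_of_nonneg]
          · refine Finset.sum_congr rfl fun b _ => ?_
            by_cases hb : b ∈ S fun i => X i ω <;> simp [Set.indicator, hω, hb]
          · intro b _
            split_ifs
            · exact responseWeight_nonneg _ _ _
            · exact le_rfl
        · simp [Set.indicator, hω]
    _ = ENNReal.ofReal δ := by simp

lemma IsLogisticSample.exists_boolResponse (h : IsLogisticSample μ X Y β₀) (ω : Ω) :
    ∃ b : Fin n → Bool, (fun i => Y i ω) = boolResponse b := by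
  classical
  refine ⟨fun i => decide (Y i ω = 1), funext fun i => ?_⟩
  rcases h.binary i ω with h | h <;> simp [boolResponse, h]

end Sample

section Measurability

variable {n p : ℕ}

lemma continuous_logisticScore (y : Fin n → ℝ) (β v : EuclideanSpace ℝ (Fin p)) :
    Continuous fun x : Fin n → EuclideanSpace ℝ (Fin p) => logisticScore x y β v := by
  have := continuous_sigmoid
  unfold logisticScore
  fun_prop

/-- As a supremum of continuous functions, the statistic is lower semicontinuous in the
covariates. -/
lemma measurable_supQuadLogRatio (y : Fin n → ℝ) (β : EuclideanSpace ℝ (Fin p))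
    (J : Finset (Fin p)) :
    Measurable fun x : Fin n → EuclideanSpace ℝ (Fin p) => supQuadLogRatio x β y J := by
  refine LowerSemicontinuous.measurable (lowerSemicontinuous_iSup fun v => ?_)
  refine (ENNReal.continuous_ofReal.comp ?_).lowerSemicontinuous
  have h1 := continuous_logisticScore y β v.1
  have := continuous_sigmoid
  unfold quadLogRatio fisherForm sigmoidVar
  fun_prop

end Measurability

/-! ### Consistency on a deterministic event -/

section Deterministic

variable {n p : ℕ} {x : Fin n → EuclideanSpace ℝ (Fin p)} {y : Fin n → ℝ}
  {β : EuclideanSpace ℝ (Fin p)} {m : ℕ} {c C Λ : ℝ}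

/-- Regularity of the log-likelihood at `β` along vectors with at most `m` nonzero coordinates:
curvature at least `c * n`, third-order remainder at most `C * n`, and score at most `Λ`. -/
structure IsRegularAt (x : Fin n → EuclideanSpace ℝ (Fin p)) (y : Fin n → ℝ)
    (β : EuclideanSpace ℝ (Fin p)) (m : ℕ) (c C Λ : ℝ) : Prop where
  fisher_ge : ∀ v, (coeffSupport v).card ≤ m → c * n * ‖v‖ ^ 2 ≤ fisherForm x β v
  third_le : ∀ v, (coeffSupport v).card ≤ m → ∑ i, |inner ℝ (x i) v| ^ 3 ≤ C * n * ‖v‖ ^ 3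
  score_le : ∀ v, (coeffSupport v).card ≤ m → |logisticScore x y β v| ≤ Λ * ‖v‖

/-- In a small ball, half of the curvature outweighs the third-order remainder. -/
lemma IsRegularAt.logLik_add_le (h : IsRegularAt x y β m c C Λ) {δ : EuclideanSpace ℝ (Fin p)}
    (hδ : (coeffSupport δ).card ≤ m) (hr : 4 * C * ‖δ‖ ≤ c) :
    logisticLogLik x y (β + δ) ≤ logisticLogLik x y β + Λ * ‖δ‖ - c * n * ‖δ‖ ^ 2 / 4 := by
  have h1 := (abs_le.1 (abs_logisticLogLik_sub_quadLogRatio_le x y β δ)).2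
  have h2 := h.fisher_ge δ hδ
  have h3 := h.third_le δ hδ
  have h4 := (le_abs_self _).trans (h.score_le δ hδ)
  have h5 : 4 * (C * n * ‖δ‖ ^ 3) ≤ c * n * ‖δ‖ ^ 2 := by
    calc 4 * (C * n * ‖δ‖ ^ 3) = (4 * C * ‖δ‖) * (n * ‖δ‖ ^ 2) := by ring
      _ ≤ c * (n * ‖δ‖ ^ 2) := by gcongr
      _ = c * n * ‖δ‖ ^ 2 := by ring
  unfold quadLogRatio at h1
  linarith

/-- By concavity, the log-likelihood decays at least linearly outside of a small ball. -/
lemma IsRegularAt.logLik_add_le_of_le_norm (h : IsRegularAt x y β m c C Λ) {ρ : ℝ} (hρ : 0 < ρ)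
    (hr : 4 * C * ρ ≤ c) (hΛ : 8 * Λ ≤ c * n * ρ) {δ : EuclideanSpace ℝ (Fin p)}
    (hδ : (coeffSupport δ).card ≤ m) (hle : ρ ≤ ‖δ‖) :
    logisticLogLik x y (β + δ) ≤ logisticLogLik x y β - ‖δ‖ / ρ * (c * n * ρ ^ 2 / 8) := by
  have hδ0 : 0 < ‖δ‖ := hρ.trans_le hle
  set t := ρ / ‖δ‖ with ht
  have ht0 : 0 < t := by positivity
  have ht1 : t ≤ 1 := (div_le_one hδ0).2 hle
  have hn : ‖t • δ‖ = ρ := by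
    rw [norm_smul, Real.norm_eq_abs, abs_of_pos ht0, ht, div_mul_cancel₀ _ hδ0.ne']
  have hs : (coeffSupport (t • δ)).card ≤ m :=
    (Finset.card_le_card (Submodule.smul_mem _ t (mem_sparseSubmodule_coeffSupport δ))).trans hδ
  have h1 := h.logLik_add_le hs (by rwa [hn])
  rw [hn] at h1
  have h2 := (concaveOn_logisticLogLik x y).2 (Set.mem_univ β) (Set.mem_univ (β + δ))
    (sub_nonneg.2 ht1) ht0.le (by ring)
  have e : (1 - t) • β + t • (β + δ) = β + t • δ := by module
  rw [e] at h2
  simp only [smul_eq_mul] at h2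
  have h3 : t * (logisticLogLik x y (β + δ) - logisticLogLik x y β) ≤ -(c * n * ρ ^ 2 / 8) := by
    have : 8 * (Λ * ρ) ≤ c * n * ρ ^ 2 := by
      calc 8 * (Λ * ρ) = (8 * Λ) * ρ := by ring
        _ ≤ (c * n * ρ) * ρ := by gcongr
        _ = c * n * ρ ^ 2 := by ring
    linarith
  have e2 : ‖δ‖ / ρ = t⁻¹ := by rw [ht, inv_div]
  rw [e2]
  have h4 := mul_le_mul_of_nonneg_left h3 (inv_pos.2 ht0).le
  rw [← mul_assoc, inv_mul_cancel₀ ht0.ne', one_mul] at h4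
  linarith

/-- The log-likelihood is coercive on a sparse model, by its linear decay, so that a maximizer
exists. -/
lemma IsRegularAt.exists_isMLE (h : IsRegularAt x y β m c C Λ) (hn : 0 < n) (hc : 0 < c) {ρ : ℝ}
    (hρ : 0 < ρ) (hr : 4 * C * ρ ≤ c) (hΛ : 8 * Λ ≤ c * n * ρ) {J : Finset (Fin p)}
    (hJ : (J ∪ coeffSupport β).card ≤ m) : ∃ b, IsMLE x y J b := by
  have hn' : (0 : ℝ) < n := by exact_mod_cast hn
  have hk : 0 < c * n * ρ ^ 2 / 8 := by positivity
  set k := c * n * ρ ^ 2 / 8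
  have hcont : Continuous fun v : sparseSubmodule J => logisticLogLik x y v :=
    (continuous_logisticLogLik x y).comp continuous_subtype_val
  obtain ⟨b, hb⟩ := hcont.exists_forall_ge' (x₀ := 0) (by
    have hlim : Tendsto (fun v : sparseSubmodule J => ‖v‖) (cocompact _) atTop :=
      tendsto_norm_cocompact_atTop
    set d := logisticLogLik x y β - logisticLogLik x y 0 with hd
    filter_upwards [hlim.eventually_ge_atTop (‖β‖ + ρ), hlim.eventually_ge_atTop (‖β‖ + d * ρ / k)]
      with v hv1 hv2
    have hsub : ‖(v : EuclideanSpace ℝ (Fin p))‖ ≤ ‖(v : EuclideanSpace ℝ (Fin p)) - β‖ + ‖β‖ := by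
      simpa using norm_add_le ((v : EuclideanSpace ℝ (Fin p)) - β) β
    rw [← Submodule.norm_coe] at hv1 hv2
    have hcard : (coeffSupport ((v : EuclideanSpace ℝ (Fin p)) - β)).card ≤ m :=
      (Finset.card_le_card (Submodule.sub_mem _
        (sparseSubmodule_mono Finset.subset_union_left v.2)
        (sparseSubmodule_mono Finset.subset_union_right
          (mem_sparseSubmodule_coeffSupport β)))).trans hJ
    have h1 := h.logLik_add_le_of_le_norm hρ hr hΛ hcard (by linarith)
    rw [add_sub_cancel] at h1
    have h2 : d ≤ ‖(v : EuclideanSpace ℝ (Fin p)) - β‖ / ρ * k := by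
      have h3 : d * ρ / k ≤ ‖(v : EuclideanSpace ℝ (Fin p)) - β‖ := by linarith
      rw [div_le_iff₀ hk] at h3
      rw [div_mul_eq_mul_div, le_div_iff₀ hρ]
      exact h3
    simp only [ZeroMemClass.coe_zero]
    change _ ≤ _ - _ * k at h1
    linarith)
  exact ⟨b, b.2, fun v hv => hb ⟨v, hv⟩⟩

/-- The rate of convergence of an estimator at least as likely as `β`. -/
lemma IsRegularAt.norm_sub_le_of_logLik_ge (h : IsRegularAt x y β m c C Λ) (hn : 0 < n)
    (hc : 0 < c) (hC : 0 ≤ C) {ρ : ℝ} (hρ : 0 < ρ) (hr : 4 * C * ρ ≤ c) (hΛ : 8 * Λ ≤ c * n * ρ)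
    {b : EuclideanSpace ℝ (Fin p)} (hb : (coeffSupport (b - β)).card ≤ m)
    (hge : logisticLogLik x y β ≤ logisticLogLik x y b) (hΛ0 : 0 ≤ Λ) :
    ‖b - β‖ ≤ 4 * Λ / (c * n) := by
  have hn' : (0 : ℝ) < n := by exact_mod_cast hn
  have hlt : ‖b - β‖ < ρ := by
    by_contra! hle
    have h1 := h.logLik_add_le_of_le_norm hρ hr hΛ hb hle
    rw [add_sub_cancel] at h1
    have h2 : 0 < ‖b - β‖ / ρ * (c * n * ρ ^ 2 / 8) := by
      have : 0 < ‖b - β‖ := hρ.trans_le hle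
      positivity
    linarith
  have h1 := h.logLik_add_le hb (le_trans (by gcongr) hr)
  rw [add_sub_cancel] at h1
  rcases (norm_nonneg (b - β)).eq_or_lt with h0 | h0
  · rw [← h0]
    positivity
  · rw [le_div_iff₀ (by positivity)]
    have h2 : ‖b - β‖ * (‖b - β‖ * (c * n)) ≤ ‖b - β‖ * (4 * Λ) := by nlinarith
    exact le_of_mul_le_mul_left h2 h0

/-- Two maximum likelihood estimators with `J₀ ⊆ J`: their likelihood ratio is controlled by the
suprema of the quadratic approximation, up to third-order terms. -/
lemma IsRegularAt.logLik_le_of_supQuadLogRatio_le (h : IsRegularAt x y β m c C Λ) (hn : 0 < n)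
    (hc : 0 < c) (hC : 0 ≤ C) (hΛ0 : 0 ≤ Λ) {ρ : ℝ} (hρ : 0 < ρ) (hr : 4 * C * ρ ≤ c)
    (hΛ : 8 * Λ ≤ c * n * ρ) {J : Finset (Fin p)} (hJ : coeffSupport β ⊆ J) (hJm : J.card ≤ m)
    {b₀ b : EuclideanSpace ℝ (Fin p)} (hb₀ : IsMLE x y (coeffSupport β) b₀)
    (hb : IsMLE x y J b) {T : ℝ} (hT : 0 ≤ T)
    (hE : supQuadLogRatio x β y J ≤ supQuadLogRatio x β y (coeffSupport β) + ENNReal.ofReal T) :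
    logisticLogLik x y b
      ≤ logisticLogLik x y b₀ + 2 * C * n * (4 * Λ / (c * n)) ^ 3 + T := by
  have hn' : (0 : ℝ) < n := by exact_mod_cast hn
  set R := 4 * Λ / (c * n) with hR
  have hR0 : 0 ≤ R := by positivity
  have hβ₀ : logisticLogLik x y β ≤ logisticLogLik x y b₀ := hb₀.2 β (Finset.Subset.refl _)
  set M := logisticLogLik x y b₀ - logisticLogLik x y β + C * n * R ^ 3 with hM
  have hrem : ∀ v, (coeffSupport v).card ≤ m → ‖v‖ ≤ R →
      |logisticLogLik x y (β + v) - logisticLogLik x y β - quadLogRatio x y β v|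
        ≤ C * n * R ^ 3 := fun v hv hvR =>
    (abs_logisticLogLik_sub_quadLogRatio_le x y β v).trans
      ((h.third_le v hv).trans (by gcongr))
  have hM0 : 0 ≤ M := by
    have : 0 ≤ C * n * R ^ 3 := by positivity
    linarith
  have h1 : supQuadLogRatio x β y (coeffSupport β) ≤ ENNReal.ofReal M := by
    refine iSup_le fun ⟨a, ha⟩ => ENNReal.ofReal_le_ofReal ?_
    simp only
    rcases lt_or_ge (quadLogRatio x y β a) 0 with hneg | hpos
    · linarith
    have hcard : (coeffSupport a).card ≤ m :=
      (Finset.card_le_card (Finset.Subset.trans ha hJ)).trans hJm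
    have haR : ‖a‖ ≤ R := by
      rcases (norm_nonneg a).eq_or_lt with h0 | h0
      · rw [← h0]
        exact hR0
      have h2 := h.fisher_ge a hcard
      have h3 := (le_abs_self _).trans (h.score_le a hcard)
      unfold quadLogRatio at hpos
      rw [hR, le_div_iff₀ (by positivity)]
      have h4 : ‖a‖ * (‖a‖ * (c * n)) ≤ ‖a‖ * (4 * Λ) := by nlinarith [mul_nonneg hΛ0 h0.le]
      exact le_of_mul_le_mul_left h4 h0
    have h2 := (abs_le.1 (hrem a hcard haR)).1
    have h3 := hb₀.2 (β + a) (Submodule.add_mem _ (mem_sparseSubmodule_coeffSupport β) ha)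
    linarith
  have hsub : b - β ∈ sparseSubmodule J := Submodule.sub_mem _ hb.1
    (sparseSubmodule_mono hJ (mem_sparseSubmodule_coeffSupport β))
  have hcard : (coeffSupport (b - β)).card ≤ m := (Finset.card_le_card hsub).trans hJm
  have hbR := h.norm_sub_le_of_logLik_ge hn hc hC hρ hr hΛ hcard (hb.2 β hJ) hΛ0
  have h2 := (abs_le.1 (hrem _ hcard hbR)).2
  rw [add_sub_cancel] at h2
  have h3 : ENNReal.ofReal (quadLogRatio x y β (b - β)) ≤ ENNReal.ofReal (M + T) := by
    rw [ENNReal.ofReal_add hM0 hT]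
    exact (le_iSup (fun v : sparseSubmodule J => ENNReal.ofReal (quadLogRatio x y β v))
      ⟨b - β, hsub⟩).trans (hE.trans (by gcongr))
  have h4 := (ENNReal.ofReal_le_ofReal_iff (by positivity)).1 h3
  linarith

/-- The extended BIC selects the true model on the event that the log-likelihood is regular and
that no superset of the true model has a quadratic likelihood ratio above `T` per superfluous
index, if the penalty per index exceeds `2 * T` and is small compared to the loss of likelihood in
a model that misses an index. -/
lemma IsRegularAt.isBICArgmin {q : ℕ} (h : IsRegularAt x y β (2 * q) c C Λ) (hn : 0 < n)
    (hc : 0 < c) (hC : 0 ≤ C) (hΛ0 : 0 ≤ Λ) {ρ : ℝ} (hρ : 0 < ρ) (hr : 4 * C * ρ ≤ c)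
    (hΛ : 8 * Λ ≤ c * n * ρ) (hβ : ∀ j ∈ coeffSupport β, ρ ≤ |β j|)
    (hq : (coeffSupport β).card ≤ q) {γ T : ℝ} (hT : 0 ≤ T)
    (hpen : q * (Real.log n + 2 * γ * Real.log p) < c * n * ρ ^ 2 / 4)
    (hTpen : 2 * C * n * (4 * Λ / (c * n)) ^ 3 + T < (Real.log n + 2 * γ * Real.log p) / 2)
    (hE : ∀ J, coeffSupport β ⊆ J → J.card ≤ q →
      supQuadLogRatio x β y J ≤ supQuadLogRatio x β y (coeffSupport β)
        + ENNReal.ofReal (T * (J \ coeffSupport β).card)) :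
    IsBICArgmin γ q x y (coeffSupport β) := by
  classical
  have hn' : (0 : ℝ) < n := by exact_mod_cast hn
  set J₀ := coeffSupport β with hJ₀
  set pen := Real.log n + 2 * γ * Real.log p with hpdef
  have hrem : 0 ≤ 2 * C * n * (4 * Λ / (c * n)) ^ 3 := by positivity
  have hpen0 : 0 < pen := by linarith
  have hunion : ∀ J : Finset (Fin p), J.card ≤ q → (J ∪ J₀).card ≤ 2 * q := fun J hJ =>
    (Finset.card_union_le _ _).trans (by omega)
  have hex : ∀ J : Finset (Fin p), ∃ b, J.card ≤ q → IsMLE x y J b := by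
    intro J
    by_cases hJ : J.card ≤ q
    · obtain ⟨b, hb⟩ := h.exists_isMLE hn hc hρ hr hΛ (hunion J hJ)
      exact ⟨b, fun _ => hb⟩
    · exact ⟨0, fun hJ' => absurd hJ' hJ⟩
  choose b hb using hex
  refine ⟨hq, b, hb, fun J hJq hne => ?_⟩
  unfold extendedBIC
  rw [← hpdef]
  by_cases hJ : J₀ ⊆ J
  · have h1 := h.logLik_le_of_supQuadLogRatio_le hn hc hC hΛ0 hρ hr hΛ hJ
      (hJq.trans (by omega)) (hb J₀ hq) (hb J hJq) (by positivity) (hE J hJ hJq)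
    have hcard : (J \ J₀).card + J₀.card = J.card := Finset.card_sdiff_add_card_eq_card hJ
    have hk : 1 ≤ (J \ J₀).card := by
      rw [Nat.one_le_iff_ne_zero, Finset.card_ne_zero, Finset.sdiff_nonempty]
      exact fun h' => hne (Finset.Subset.antisymm h' hJ)
    have hk' : (1 : ℝ) ≤ (J \ J₀).card := by exact_mod_cast hk
    have hcard' : (J.card : ℝ) = (J \ J₀).card + J₀.card := by exact_mod_cast hcard.symm
    set k : ℝ := ((J \ J₀).card : ℝ)
    rw [hcard']
    have h2 : k * (2 * C * n * (4 * Λ / (c * n)) ^ 3 + T) < k * (pen / 2) := by gcongr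
    have h3 : 2 * C * n * (4 * Λ / (c * n)) ^ 3 ≤ k * (2 * C * n * (4 * Λ / (c * n)) ^ 3) :=
      le_mul_of_one_le_left hrem hk'
    linarith
  · obtain ⟨j, hj₀, hjJ⟩ := Finset.not_subset.1 hJ
    have hbJ := hb J hJq
    have hj : (b J) j = 0 := (mem_sparseSubmodule'.1 hbJ.1) j hjJ
    have hnorm : ρ ≤ ‖b J - β‖ := by
      refine (hβ j hj₀).trans ?_
      have := PiLp.norm_apply_le (b J - β) j
      simpa [hj] using this
    have hcard : (coeffSupport (b J - β)).card ≤ 2 * q :=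
      (Finset.card_le_card (Submodule.sub_mem _
        (sparseSubmodule_mono Finset.subset_union_left hbJ.1)
        (sparseSubmodule_mono Finset.subset_union_right
          (mem_sparseSubmodule_coeffSupport β)))).trans (hunion J hJq)
    have h1 := h.logLik_add_le_of_le_norm hρ hr hΛ hcard hnorm
    rw [add_sub_cancel] at h1
    have h2 : c * n * ρ ^ 2 / 8 ≤ ‖b J - β‖ / ρ * (c * n * ρ ^ 2 / 8) :=
      le_mul_of_one_le_left (by positivity) ((one_le_div hρ).2 hnorm)
    have h3 := (hb J₀ hq).2 β (Finset.Subset.refl _)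
    have h4 : (J₀.card : ℝ) * pen ≤ q * pen := by gcongr
    have h5 : 0 ≤ (J.card : ℝ) * pen := by positivity
    linarith

end Deterministic

/-! ### Concentration inequalities -/

section Concentration

variable {Ω : Type*} [MeasurableSpace Ω] {μ : Measure Ω} [IsProbabilityMeasure μ] {n : ℕ}
  {Z : Fin n → Ω → ℝ}

/-- Hoeffding's inequality, two-sided, for variables bounded by `B`. -/
lemma measure_lt_abs_sum_sub_integral_le (hind : iIndepFun Z μ) (hm : ∀ i, Measurable (Z i))
    {B : ℝ} (hB : 0 ≤ B) (hZ : ∀ i, ∀ᵐ ω ∂μ, |Z i ω| ≤ B) {s : ℝ} (hs : 0 ≤ s) :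
    μ {ω | s < |∑ i, (Z i ω - ∫ ω', Z i ω' ∂μ)|}
      ≤ ENNReal.ofReal (2 * Real.exp (-(s ^ 2 / (2 * n * B ^ 2)))) := by
  have hcB : (((‖B - -B‖₊ / 2) ^ 2 : NNReal) : ℝ) = B ^ 2 := by
    rw [NNReal.coe_pow, NNReal.coe_div, coe_nnnorm, Real.norm_eq_abs, sub_neg_eq_add,
      abs_of_nonneg (by linarith), NNReal.coe_ofNat, add_self_div_two]
  have hsub : ∀ i, HasSubgaussianMGF (fun ω => Z i ω - ∫ ω', Z i ω' ∂μ)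
      ((‖B - -B‖₊ / 2) ^ 2) μ := fun i =>
    hasSubgaussianMGF_of_mem_Icc (hm i).aemeasurable ((hZ i).mono fun ω hω => abs_le.1 hω)
  have hind' : iIndepFun (fun i ω => Z i ω - ∫ ω', Z i ω' ∂μ) μ :=
    hind.comp (fun i z => z - ∫ ω', Z i ω' ∂μ) fun i => measurable_id.sub_const _
  have hneg : iIndepFun (fun i ω => -(Z i ω - ∫ ω', Z i ω' ∂μ)) μ :=
    hind'.comp (fun _ z => -z) fun _ => measurable_neg
  have e : -(s ^ 2 / (2 * n * B ^ 2)) = -s ^ 2 / (2 * ∑ _i : Fin n, B ^ 2) := by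
    simp
    ring
  have h1 := HasSubgaussianMGF.measure_sum_ge_le_of_iIndepFun hind' (s := Finset.univ)
    (fun i _ => hsub i) hs
  have h2 := HasSubgaussianMGF.measure_sum_ge_le_of_iIndepFun hneg (s := Finset.univ)
    (fun i _ => (hsub i).neg) hs
  simp only [NNReal.coe_sum, hcB] at h1 h2
  rw [← e] at h1 h2
  have hcover : {ω | s < |∑ i, (Z i ω - ∫ ω', Z i ω' ∂μ)|}
      ⊆ {ω | s ≤ ∑ i, (Z i ω - ∫ ω', Z i ω' ∂μ)} ∪ {ω | s ≤ ∑ i, -(Z i ω - ∫ ω', Z i ω' ∂μ)} := by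
    intro ω hω
    rw [Set.mem_ofPred_eq, lt_abs] at hω
    rcases hω with h | h
    · exact Or.inl h.le
    · right
      simp only [Set.mem_ofPred_eq, Finset.sum_neg_distrib]
      exact h.le
  refine (measure_mono hcover).trans ((measure_union_le _ _).trans ?_)
  rw [two_mul, ENNReal.ofReal_add (by positivity) (by positivity)]
  rw [← ofReal_measureReal, ← ofReal_measureReal]
  gcongr

/-- A multiplicative Chernoff bound: a sum of variables in `[0, M]` with means at most `a` exceeds
`3 * n * a` with probability at most `exp (-n * a / M)`. -/
lemma measure_three_mul_le_sum_le (hind : iIndepFun Z μ) (hm : ∀ i, Measurable (Z i))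
    {M a : ℝ} (hM : 0 < M) (hZ0 : ∀ i ω, 0 ≤ Z i ω) (hZ : ∀ i, ∀ᵐ ω ∂μ, Z i ω ≤ M)
    (ha : ∀ i, ∫ ω, Z i ω ∂μ ≤ a) :
    μ {ω | 3 * n * a ≤ ∑ i, Z i ω} ≤ ENNReal.ofReal (Real.exp (-(n * a / M))) := by
  have hint : ∀ i, Integrable (Z i) μ := fun i =>
    Integrable.of_mem_Icc 0 M (hm i).aemeasurable ((hZ i).mono fun ω hω => ⟨hZ0 i ω, hω⟩)
  have hbd : ∀ i, ∀ᵐ ω ∂μ, Real.exp (M⁻¹ * Z i ω) ≤ 1 + 2 * (M⁻¹ * Z i ω) := by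
    intro i
    filter_upwards [hZ i] with ω hω
    have h0 : 0 ≤ M⁻¹ * Z i ω := mul_nonneg (by positivity) (hZ0 i ω)
    have h1 : M⁻¹ * Z i ω ≤ 1 := by
      rw [inv_mul_le_iff₀ hM, mul_one]
      exact hω
    have := Real.abs_exp_sub_one_le (x := M⁻¹ * Z i ω) (by rwa [abs_of_nonneg h0])
    rw [abs_of_nonneg h0] at this
    linarith [le_abs_self (Real.exp (M⁻¹ * Z i ω) - 1)]
  have hexp : ∀ i, Integrable (fun ω => Real.exp (M⁻¹ * Z i ω)) μ := by
    intro i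
    refine Integrable.of_mem_Icc 0 (Real.exp 1) (by fun_prop) ?_
    filter_upwards [hZ i] with ω hω
    refine ⟨(Real.exp_pos _).le, Real.exp_le_exp.2 ?_⟩
    rw [inv_mul_le_iff₀ hM, mul_one]
    exact hω
  have hmgf : ∀ i, mgf (Z i) μ M⁻¹ ≤ Real.exp (2 * a / M) := by
    intro i
    calc mgf (Z i) μ M⁻¹ ≤ ∫ ω, (1 + 2 * (M⁻¹ * Z i ω)) ∂μ :=
          integral_mono_ae (hexp i)
            ((integrable_const _).add (((hint i).const_mul _).const_mul _)) (hbd i)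
      _ = 1 + 2 * (M⁻¹ * ∫ ω, Z i ω ∂μ) := by
          rw [integral_add (integrable_const _) (((hint i).const_mul _).const_mul _),
            integral_const_mul, integral_const_mul]
          simp
      _ ≤ 1 + 2 * (M⁻¹ * a) := by
          have := ha i
          gcongr
      _ ≤ Real.exp (2 * a / M) := by
          have := Real.add_one_le_exp (2 * a / M)
          have e : 2 * (M⁻¹ * a) = 2 * a / M := by
            field_simp
          rw [e]
          linarith
  have hsum := hind.mgf_sum hm Finset.univ (t := M⁻¹)
  have hint' : Integrable (fun ω => Real.exp (M⁻¹ * (∑ i, Z i) ω)) μ :=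
    hind.integrable_exp_mul_sum hm fun i _ => hexp i
  have h := measure_ge_le_exp_mul_mgf (μ := μ) (X := ∑ i, Z i) (t := M⁻¹) (3 * n * a)
    (by positivity) hint'
  rw [← ofReal_measureReal]
  refine ENNReal.ofReal_le_ofReal ?_
  simp only [Finset.sum_apply] at h
  refine h.trans ?_
  rw [hsum]
  have hprod : ∏ i, mgf (Z i) μ M⁻¹ ≤ Real.exp (2 * a / M) ^ n := by
    refine (Finset.prod_le_prod (fun i _ => mgf_nonneg) fun i _ => hmgf i).trans ?_
    simp
  refine (mul_le_mul_of_nonneg_left hprod (Real.exp_pos _).le).trans (le_of_eq ?_)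
  rw [← Real.exp_nat_mul, ← Real.exp_add]
  congr 1
  field_simp
  ring

end Concentration

/-! ### Families of index sets -/

lemma sum_pow_card_eq {p : ℕ} (z : ℝ) : ∑ J : Finset (Fin p), z ^ J.card = (1 + z) ^ p := by
  have := Finset.sum_pow_mul_eq_add_pow z 1 (Finset.univ : Finset (Fin p))
  simp only [one_pow, mul_one, Finset.powerset_univ, Finset.card_univ, Fintype.card_fin] at this
  rw [this, add_comm]

lemma one_add_pow_le_exp_mul {z : ℝ} (hz : 0 ≤ z) (p : ℕ) : (1 + z) ^ p ≤ Real.exp (p * z) := by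
  rw [Real.exp_nat_mul]
  have := Real.add_one_le_exp z
  exact pow_le_pow_left₀ (by linarith) (by linarith) p

lemma card_filter_card_le_le {p : ℕ} (hp : 0 < p) (m : ℕ) :
    ((Finset.univ.filter fun J : Finset (Fin p) => J.card ≤ m).card : ℝ)
      ≤ Real.exp 1 * (p : ℝ) ^ m := by
  have hp' : (1 : ℝ) ≤ p := by exact_mod_cast hp
  -- Each set counted has weight at least `1` under `J ↦ p ^ m * p ^ (-|J|)`.
  have h1 : ((Finset.univ.filter fun J : Finset (Fin p) => J.card ≤ m).card : ℝ)
      ≤ ∑ J : Finset (Fin p), (p : ℝ) ^ m * ((p : ℝ)⁻¹) ^ J.card := by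
    rw [Finset.card_eq_sum_ones, Nat.cast_sum, Nat.cast_one]
    refine (Finset.sum_le_sum fun J hJ => ?_).trans
      (Finset.sum_le_sum_of_subset_of_nonneg (Finset.filter_subset _ _) fun J _ _ => by positivity)
    have := (Finset.mem_filter.1 hJ).2
    rw [inv_pow, ← div_eq_mul_inv, one_le_div (by positivity)]
    exact pow_le_pow_right₀ hp' this
  refine h1.trans ?_
  rw [← Finset.mul_sum, sum_pow_card_eq, mul_comm]
  gcongr
  refine (one_add_pow_le_exp_mul (by positivity) p).trans (le_of_eq ?_)
  rw [mul_inv_cancel₀ (by positivity)]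

/-! ### Random designs -/

/-- The designs with entries bounded by `A` whose empirical second moments are at least `c` and
whose empirical third absolute moments are at most `C` in all directions with at most `m` nonzero
coordinates. -/
def goodDesign (n p m : ℕ) (c C A : ℝ) : Set (Fin n → EuclideanSpace ℝ (Fin p)) :=
  {x | (∀ i j, |x i j| ≤ A) ∧ ∀ u, (coeffSupport u).card ≤ m →
    c * n * ‖u‖ ^ 2 ≤ ∑ i, (inner ℝ (x i) u) ^ 2 ∧
    ∑ i, |inner ℝ (x i) u| ^ 3 ≤ C * n * ‖u‖ ^ 3}

lemma isClosed_goodDesign (n p m : ℕ) (c C A : ℝ) : IsClosed (goodDesign n p m c C A) := by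
  unfold goodDesign
  simp only [Set.ofPred_and, Set.ofPred_forall]
  refine IsClosed.inter ?_ ?_
  · exact isClosed_iInter fun i => isClosed_iInter fun j =>
      isClosed_le (by fun_prop) continuous_const
  · exact isClosed_iInter fun u => isClosed_iInter fun _ =>
      (isClosed_le continuous_const (by fun_prop)).inter
        (isClosed_le (by fun_prop) continuous_const)

section DesignDeterministic

variable {n p m : ℕ} {x : Fin n → EuclideanSpace ℝ (Fin p)} {A : ℝ}

/-- Entrywise control of an empirical quadratic form suffices on sparse vectors, whose `ℓ¹` norm is
at most `√m` times the `ℓ²` norm. -/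
lemma sum_inner_sq_ge_of_entrywise {Sig : Fin p → Fin p → ℝ} {t : ℝ}
    (hS : ∀ j k, |∑ i, x i j * x i k - Sig j k| ≤ t) {u : EuclideanSpace ℝ (Fin p)}
    (hu : (coeffSupport u).card ≤ m) :
    ∑ j, ∑ k, u j * u k * Sig j k - t * (m * ‖u‖ ^ 2) ≤ ∑ i, (inner ℝ (x i) u) ^ 2 := by
  have e : ∑ i, (inner ℝ (x i) u) ^ 2 = ∑ j, ∑ k, u j * u k * ∑ i, x i j * x i k := by
    have e1 : ∀ i, (inner ℝ (x i) u) ^ 2 = ∑ j, ∑ k, u j * u k * (x i j * x i k) := by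
      intro i
      simp only [pow_two, PiLp.inner_apply, RCLike.inner_apply, conj_trivial, Finset.sum_mul_sum]
      exact Finset.sum_congr rfl fun j _ => Finset.sum_congr rfl fun k _ => by ring
    simp only [e1, Finset.mul_sum]
    rw [Finset.sum_comm]
    exact Finset.sum_congr rfl fun j _ => Finset.sum_comm
  have h1 : ∑ j, ∑ k, u j * u k * Sig j k - ∑ i, (inner ℝ (x i) u) ^ 2
      ≤ ∑ j, ∑ k, |u j| * |u k| * t := by
    rw [e, ← Finset.sum_sub_distrib]
    refine Finset.sum_le_sum fun j _ => ?_
    rw [← Finset.sum_sub_distrib]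
    refine Finset.sum_le_sum fun k _ => ?_
    rw [← mul_sub]
    refine (le_abs_self _).trans ?_
    rw [abs_mul, abs_mul, abs_sub_comm]
    gcongr
    exact hS j k
  have h2 : ∑ j, ∑ k, |u j| * |u k| * t = t * (∑ j, |u j|) ^ 2 := by
    rw [pow_two, Finset.sum_mul_sum, Finset.mul_sum]
    refine Finset.sum_congr rfl fun j _ => ?_
    rw [Finset.mul_sum]
    exact Finset.sum_congr rfl fun k _ => by ring
  have h3 : (∑ j, |u j|) ^ 2 ≤ m * ‖u‖ ^ 2 := by
    have h4 := sum_abs_le_of_mem_sparseSubmodule (mem_sparseSubmodule_coeffSupport u)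
    calc (∑ j, |u j|) ^ 2 ≤ (√(coeffSupport u).card * ‖u‖) ^ 2 := by
          have : 0 ≤ ∑ j, |u j| := Finset.sum_nonneg fun _ _ => abs_nonneg _
          gcongr
      _ = (coeffSupport u).card * ‖u‖ ^ 2 := by
          rw [mul_pow, Real.sq_sqrt (Nat.cast_nonneg _)]
      _ ≤ _ := by gcongr
  rcases isEmpty_or_nonempty (Fin p) with hp | ⟨⟨j⟩⟩
  · have : u = 0 := Subsingleton.elim _ _
    simp [this]
  · have ht : 0 ≤ t := (abs_nonneg _).trans (hS j j)
    have h5 := mul_le_mul_of_nonneg_left h3 ht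
    linarith

/-- Third moments on a net of radius `1 / √m` control third moments on the unit ball of a model of
size `m`: in the error direction the covariates are bounded by `A`, by the Cauchy-Schwarz
inequality. -/
lemma sum_abs_inner_pow_le_of_net {J : Finset (Fin p)} {N : Finset (sparseSubmodule J)}
    (hA : 0 ≤ A) (hx : ∀ i j, |x i j| ≤ A) (hJ : J.card ≤ m) (hm : 0 < m)
    (hN : ∀ v : sparseSubmodule J, ‖v‖ ≤ 1 → ∃ w ∈ N, ‖v - w‖ ≤ 1 / √m) {B : ℝ}
    (hB : ∀ w ∈ N, ∑ i, |inner ℝ (x i) (w : EuclideanSpace ℝ (Fin p))| ^ 3 ≤ B * n)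
    {u : EuclideanSpace ℝ (Fin p)} (hu : u ∈ sparseSubmodule J) :
    ∑ i, |inner ℝ (x i) u| ^ 3 ≤ 4 * (B + A ^ 3) * n * ‖u‖ ^ 3 := by
  have hm' : (0 : ℝ) < m := by exact_mod_cast hm
  have key : ∀ v ∈ sparseSubmodule J, ‖v‖ ≤ 1 →
      ∑ i, |inner ℝ (x i) v| ^ 3 ≤ 4 * (B + A ^ 3) * n := by
    intro v hv hv1
    obtain ⟨w, hwN, hw⟩ := hN ⟨v, hv⟩ hv1
    have hdiff : ∀ i, |inner ℝ (x i) (v - w)| ≤ A := by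
      intro i
      have h1 := abs_inner_le_of_mem_sparseSubmodule (Submodule.sub_mem _ hv w.2) hA (hx i)
      refine h1.trans (mul_le_of_le_one_right hA ?_)
      have hw' : ‖v - (w : EuclideanSpace ℝ (Fin p))‖ ≤ 1 / √m := hw
      calc √J.card * ‖v - (w : EuclideanSpace ℝ (Fin p))‖ ≤ √m * (1 / √m) := by gcongr
        _ = 1 := mul_one_div_cancel (by positivity)
    have hpt : ∀ i, |inner ℝ (x i) v| ^ 3
        ≤ 4 * (|inner ℝ (x i) (w : EuclideanSpace ℝ (Fin p))| ^ 3 + A ^ 3) := by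
      intro i
      have e : (inner ℝ (x i) v : ℝ) = inner ℝ (x i) (w : EuclideanSpace ℝ (Fin p))
          + inner ℝ (x i) (v - w) := by
        rw [inner_sub_right]
        ring
      have h1 : |inner ℝ (x i) v| ≤ |inner ℝ (x i) (w : EuclideanSpace ℝ (Fin p))| + A := by
        rw [e]
        exact (abs_add_le _ _).trans (by gcongr; exact hdiff i)
      calc |inner ℝ (x i) v| ^ 3
          ≤ (|inner ℝ (x i) (w : EuclideanSpace ℝ (Fin p))| + A) ^ 3 := by gcongr
        _ ≤ 2 ^ (3 - 1) * (|inner ℝ (x i) (w : EuclideanSpace ℝ (Fin p))| ^ 3 + A ^ 3) :=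
          add_pow_le (abs_nonneg _) hA 3
        _ = _ := by norm_num
    calc ∑ i, |inner ℝ (x i) v| ^ 3
        ≤ ∑ i, 4 * (|inner ℝ (x i) (w : EuclideanSpace ℝ (Fin p))| ^ 3 + A ^ 3) :=
          Finset.sum_le_sum fun i _ => hpt i
      _ = 4 * (∑ i, |inner ℝ (x i) (w : EuclideanSpace ℝ (Fin p))| ^ 3 + n * A ^ 3) := by
          rw [← Finset.mul_sum, Finset.sum_add_distrib]
          simp
      _ ≤ 4 * (B * n + n * A ^ 3) := by
          have := hB w hwN
          gcongr
      _ = _ := by ring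
  rcases (norm_nonneg u).eq_or_lt with h0 | h0
  · have : u = 0 := norm_eq_zero.1 h0.symm
    simp [this]
  · have h1 := key (‖u‖⁻¹ • u) (Submodule.smul_mem _ _ hu) (by
      rw [norm_smul, norm_inv, norm_norm, inv_mul_cancel₀ h0.ne'])
    have e : ∑ i, |inner ℝ (x i) u| ^ 3
        = (∑ i, |inner ℝ (x i) (‖u‖⁻¹ • u)| ^ 3) * ‖u‖ ^ 3 := by
      rw [Finset.sum_mul]
      refine Finset.sum_congr rfl fun i _ => ?_
      rw [inner_smul_right, abs_mul, mul_pow, abs_of_pos (inv_pos.2 h0)]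
      field_simp
    rw [e]
    gcongr

end DesignDeterministic

section DesignRandom

variable {Ω : Type*} [MeasurableSpace Ω] {μ : Measure Ω} {n p m : ℕ}
  {X : Fin n → Ω → EuclideanSpace ℝ (Fin p)} {a₁ a₂ A : ℝ}

lemma CovariateAssumptions.integral_abs_inner_pow_le {X : Ω → EuclideanSpace ℝ (Fin p)}
    (h : CovariateAssumptions μ X m a₁ a₂ A) (ha₂ : 0 ≤ a₂) {v : EuclideanSpace ℝ (Fin p)}
    (hv : (coeffSupport v).card ≤ m) (hv1 : ‖v‖ ≤ 1) : ∫ ω, |inner ℝ (X ω) v| ^ 3 ∂μ ≤ a₂ := by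
  rcases (norm_nonneg v).eq_or_lt with h0 | h0
  · have : v = 0 := norm_eq_zero.1 h0.symm
    simpa [this] using ha₂
  · have h1 := h.third_moment (‖v‖⁻¹ • v)
      (by rw [norm_smul, norm_inv, norm_norm, inv_mul_cancel₀ h0.ne'])
      ((Finset.card_le_card (Submodule.smul_mem _ _ (mem_sparseSubmodule_coeffSupport v))).trans hv)
    have e : ∀ ω, |inner ℝ (X ω) v| ^ 3 = ‖v‖ ^ 3 * |inner ℝ (X ω) (‖v‖⁻¹ • v)| ^ 3 := by
      intro ω
      rw [inner_smul_right, abs_mul, mul_pow, abs_of_pos (inv_pos.2 h0)]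
      field_simp
    rw [integral_congr_ae (ae_of_all _ e), integral_const_mul]
    calc _ ≤ ‖v‖ ^ 3 * a₂ := by gcongr
      _ ≤ 1 * a₂ := by
          gcongr
          exact pow_le_one₀ h0.le hv1
      _ = a₂ := one_mul _

/-- The lower bound of second moments, in terms of the second moment matrix. -/
lemma CovariateAssumptions.sum_integral_ge [IsFiniteMeasure μ] {X : Ω → EuclideanSpace ℝ (Fin p)}
    (h : CovariateAssumptions μ X m a₁ a₂ A) (hX : Measurable X)
    {u : EuclideanSpace ℝ (Fin p)} (hu : (coeffSupport u).card ≤ m) :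
    a₁ * ‖u‖ ^ 2 ≤ ∑ j, ∑ k, u j * u k * ∫ ω, X ω j * X ω k ∂μ := by
  have hXj : ∀ j, Measurable fun ω => X ω j := fun j =>
    (EuclideanSpace.proj (𝕜 := ℝ) j).continuous.measurable.comp hX
  have hint : ∀ j k, Integrable (fun ω => X ω j * X ω k) μ := by
    intro j k
    refine Integrable.of_bound ((hXj j).mul (hXj k)).aestronglyMeasurable (A * A) ?_
    filter_upwards [h.bounded j, h.bounded k] with ω h1 h2
    rw [Real.norm_eq_abs, abs_mul]
    exact mul_le_mul h1 h2 (abs_nonneg _) ((abs_nonneg _).trans h1)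
  have hexp : ∀ v : EuclideanSpace ℝ (Fin p), ∫ ω, (inner ℝ (X ω) v) ^ 2 ∂μ
      = ∑ j, ∑ k, v j * v k * ∫ ω, X ω j * X ω k ∂μ := by
    intro v
    have e : ∀ ω, (inner ℝ (X ω) v) ^ 2 = ∑ j, ∑ k, v j * v k * (X ω j * X ω k) := by
      intro ω
      simp only [pow_two, PiLp.inner_apply, RCLike.inner_apply, conj_trivial, Finset.sum_mul_sum]
      exact Finset.sum_congr rfl fun j _ => Finset.sum_congr rfl fun k _ => by ring
    rw [integral_congr_ae (ae_of_all _ e), integral_finsetSum _ fun j _ =>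
      integrable_finsetSum _ fun k _ => (hint j k).const_mul _]
    refine Finset.sum_congr rfl fun j _ => ?_
    rw [integral_finsetSum _ fun k _ => (hint j k).const_mul _]
    exact Finset.sum_congr rfl fun k _ => integral_const_mul _ _
  rw [← hexp]
  rcases (norm_nonneg u).eq_or_lt with h0 | h0
  · have : u = 0 := norm_eq_zero.1 h0.symm
    simp [this]
  · have h1 := h.second_moment (‖u‖⁻¹ • u)
      (by rw [norm_smul, norm_inv, norm_norm, inv_mul_cancel₀ h0.ne'])
      ((Finset.card_le_card (Submodule.smul_mem _ _ (mem_sparseSubmodule_coeffSupport u))).trans hu)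
    have e : ∀ ω, (inner ℝ (X ω) u) ^ 2 = (inner ℝ (X ω) (‖u‖⁻¹ • u)) ^ 2 * ‖u‖ ^ 2 := by
      intro ω
      rw [inner_smul_right, mul_pow]
      field_simp
    rw [integral_congr_ae (ae_of_all _ e), integral_mul_const]
    gcongr

/-- The sample is a good design with high probability. -/
lemma measure_notMem_goodDesign_le [IsProbabilityMeasure μ] (hX : ∀ i, Measurable (X i))
    (hind : iIndepFun X μ) (h : ∀ i, CovariateAssumptions μ (X i) m a₁ a₂ A) (ha₁ : 0 < a₁)
    (ha₂ : 0 < a₂) (hA : 0 < A) (hm : 0 < m) (hp : 0 < p) :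
    μ {ω | (fun i => X i ω) ∉ goodDesign n p m (a₁ / 2) (4 * (3 * a₂ + A ^ 3)) A}
      ≤ ENNReal.ofReal (2 * p ^ 2 * Real.exp (-((n * (a₁ / (2 * m))) ^ 2 / (2 * n * (A * A) ^ 2))))
        + ENNReal.ofReal (Real.exp 1 * p ^ m * (1 + 2 * √m) ^ m
            * Real.exp (-(n * a₂ / (A * √m) ^ 3))) := by
  classical
  have hm' : (0 : ℝ) < m := by exact_mod_cast hm
  have hXj : ∀ i j, Measurable fun ω => X i ω j := fun i j =>
    (EuclideanSpace.proj (𝕜 := ℝ) j).continuous.measurable.comp (hX i)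
  have hbdd : ∀ᵐ ω ∂μ, ∀ i j, |X i ω j| ≤ A :=
    ae_all_iff.2 fun i => ae_all_iff.2 fun j => (h i).bounded j
  choose N hN1 hN2 hN3 using fun J : Finset (Fin p) =>
    exists_finset_net_unitBall (E := sparseSubmodule J) (η := 1 / √m) (by positivity)
  set E2 : Fin p × Fin p → Set Ω := fun jk => {ω | n * (a₁ / (2 * m)) <
    |∑ i, (X i ω jk.1 * X i ω jk.2 - ∫ ω', X i ω' jk.1 * X i ω' jk.2 ∂μ)|} with hE2
  set E3 : (J : Finset (Fin p)) → sparseSubmodule J → Set Ω := fun J w =>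
    {ω | 3 * n * a₂ ≤ ∑ i, |inner ℝ (X i ω) (w : EuclideanSpace ℝ (Fin p))| ^ 3} with hE3
  set 𝒥 := Finset.univ.filter fun J : Finset (Fin p) => J.card ≤ m with h𝒥
  have hcover : {ω | (fun i => X i ω) ∉ goodDesign n p m (a₁ / 2) (4 * (3 * a₂ + A ^ 3)) A}
      ⊆ ({ω | ¬ ∀ i j, |X i ω j| ≤ A} ∪ ⋃ jk, E2 jk) ∪ ⋃ J ∈ 𝒥, ⋃ w ∈ N J, E3 J w := by
    intro ω hω
    by_contra hcon
    rw [Set.mem_union, Set.mem_union, not_or, not_or] at hcon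
    obtain ⟨⟨hb, h2⟩, h3⟩ := hcon
    rw [Set.mem_ofPred_eq, not_not] at hb
    refine hω ⟨hb, fun u hu => ⟨?_, ?_⟩⟩
    · have h2' : ∀ j k, |∑ i, X i ω j * X i ω k - ∑ i, ∫ ω', X i ω' j * X i ω' k ∂μ|
          ≤ n * (a₁ / (2 * m)) := by
        intro j k
        by_contra! hlt
        refine h2 (Set.mem_iUnion.2 ⟨(j, k), ?_⟩)
        rw [← Finset.sum_sub_distrib] at hlt
        exact hlt
      have h4 := sum_inner_sq_ge_of_entrywise h2' hu
      have h5 : n * (a₁ * ‖u‖ ^ 2)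
          ≤ ∑ j, ∑ k, u j * u k * ∑ i, ∫ ω', X i ω' j * X i ω' k ∂μ := by
        have e : ∑ j, ∑ k, u j * u k * ∑ i, ∫ ω', X i ω' j * X i ω' k ∂μ
            = ∑ i, ∑ j, ∑ k, u j * u k * ∫ ω', X i ω' j * X i ω' k ∂μ := by
          simp only [Finset.mul_sum]
          rw [Finset.sum_comm]
          refine Eq.trans ?_ Finset.sum_comm
          rw [Finset.sum_comm]
          exact Finset.sum_congr rfl fun j _ => Finset.sum_comm
        rw [e]
        calc n * (a₁ * ‖u‖ ^ 2) = ∑ _i : Fin n, a₁ * ‖u‖ ^ 2 := by simp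
          _ ≤ _ := Finset.sum_le_sum fun i _ => (h i).sum_integral_ge (hX i) hu
      have e : n * (a₁ / (2 * m)) * (m * ‖u‖ ^ 2) = n * (a₁ * ‖u‖ ^ 2) / 2 := by
        field_simp
      rw [e] at h4
      have : a₁ / 2 * n * ‖u‖ ^ 2 = n * (a₁ * ‖u‖ ^ 2) / 2 := by ring
      linarith
    · refine sum_abs_inner_pow_le_of_net hA.le hb hu hm (hN2 _) (fun w hw => ?_)
        (mem_sparseSubmodule_coeffSupport u)
      by_contra! hlt
      refine h3 (Set.mem_biUnion (Finset.mem_filter.2 ⟨Finset.mem_univ _, hu⟩)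
        (Set.mem_biUnion hw ?_))
      rw [hE3, Set.mem_ofPred_eq]
      linarith
  have hP2 : ∀ jk, μ (E2 jk) ≤ ENNReal.ofReal
      (2 * Real.exp (-((n * (a₁ / (2 * m))) ^ 2 / (2 * n * (A * A) ^ 2)))) := by
    intro jk
    refine measure_lt_abs_sum_sub_integral_le (Z := fun i ω => X i ω jk.1 * X i ω jk.2)
      (hind.comp (fun _ x => x jk.1 * x jk.2) fun _ => ?_)
      (fun i => (hXj i _).mul (hXj i _)) (by positivity) (fun i => ?_) (by positivity)
    · exact (EuclideanSpace.proj (𝕜 := ℝ) jk.1).continuous.measurable.mul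
        (EuclideanSpace.proj (𝕜 := ℝ) jk.2).continuous.measurable
    · filter_upwards [hbdd] with ω hω
      rw [abs_mul]
      exact mul_le_mul (hω i _) (hω i _) (abs_nonneg _) hA.le
  have hP3 : ∀ J ∈ 𝒥, ∀ w ∈ N J, μ (E3 J w)
      ≤ ENNReal.ofReal (Real.exp (-(n * a₂ / (A * √m) ^ 3))) := by
    intro J hJ w hw
    have hJm : J.card ≤ m := (Finset.mem_filter.1 hJ).2
    have hmeas : Measurable fun x : EuclideanSpace ℝ (Fin p) =>
        |(inner ℝ x (w : EuclideanSpace ℝ (Fin p)) : ℝ)| ^ 3 :=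
      (by fun_prop : Continuous _).measurable
    have hw1 : ‖(w : EuclideanSpace ℝ (Fin p))‖ ≤ 1 := hN1 J w hw
    refine measure_three_mul_le_sum_le (hind.comp (fun _ x =>
      |(inner ℝ x (w : EuclideanSpace ℝ (Fin p)) : ℝ)| ^ 3) fun _ => hmeas)
      (fun i => hmeas.comp (hX i)) (by positivity)
      (fun i ω => pow_nonneg (abs_nonneg _) 3) (fun i => ?_)
      (fun i => (h i).integral_abs_inner_pow_le ha₂.le ((Finset.card_le_card w.2).trans hJm) hw1)
    filter_upwards [hbdd] with ω hω
    have h1 := abs_inner_le_of_mem_sparseSubmodule w.2 hA.le (hω i)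
    have h2 : A * (√J.card * ‖(w : EuclideanSpace ℝ (Fin p))‖) ≤ A * (√m * 1) := by gcongr
    rw [mul_one] at h2
    exact pow_le_pow_left₀ (abs_nonneg _) (h1.trans h2) 3
  -- A union bound over the `p ^ 2` entries, and one over the nets of all models of size `≤ m`.
  refine (measure_mono hcover).trans ((measure_union_le _ _).trans (add_le_add ?_ ?_))
  · refine (measure_union_le _ _).trans ?_
    rw [show μ {ω | ¬ ∀ i j, |X i ω j| ≤ A} = 0 from hbdd, zero_add]
    refine (measure_iUnion_fintype_le _ _).trans ((Finset.sum_le_sum fun jk _ => hP2 jk).trans ?_)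
    rw [← ENNReal.ofReal_sum_of_nonneg fun _ _ => mul_nonneg zero_le_two (Real.exp_pos _).le]
    refine ENNReal.ofReal_le_ofReal (le_of_eq ?_)
    simp
    ring
  · refine (measure_biUnion_finset_le _ _).trans ((Finset.sum_le_sum fun J hJ =>
      (measure_biUnion_finset_le _ _).trans (Finset.sum_le_sum fun w hw => hP3 J hJ w hw)).trans ?_)
    simp only [Finset.sum_const]
    have hcard : ∀ J ∈ 𝒥, ((N J).card : ℝ) ≤ (1 + 2 * √m) ^ m := by
      intro J hJ
      refine (hN3 J).trans ?_
      have e : (2 : ℝ) / (1 / √m) = 2 * √m := by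
        field_simp
      rw [e]
      exact pow_le_pow_right₀ (by linarith [Real.sqrt_nonneg (m : ℝ)])
        ((finrank_sparseSubmodule_le J).trans (Finset.mem_filter.1 hJ).2)
    set e3 := Real.exp (-(n * a₂ / (A * √m) ^ 3)) with he3
    calc ∑ J ∈ 𝒥, (N J).card • ENNReal.ofReal e3
        = ENNReal.ofReal (∑ J ∈ 𝒥, ((N J).card : ℝ) * e3) := by
          rw [ENNReal.ofReal_sum_of_nonneg fun _ _ => by positivity]
          refine Finset.sum_congr rfl fun J _ => ?_
          rw [nsmul_eq_mul, ENNReal.ofReal_mul (Nat.cast_nonneg _), ENNReal.ofReal_natCast]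
      _ ≤ ENNReal.ofReal (∑ _J ∈ 𝒥, (1 + 2 * √m) ^ m * e3) :=
          ENNReal.ofReal_le_ofReal (Finset.sum_le_sum fun J hJ =>
            mul_le_mul_of_nonneg_right (hcard J hJ) (Real.exp_pos _).le)
      _ ≤ _ := by
          refine ENNReal.ofReal_le_ofReal ?_
          rw [Finset.sum_const, nsmul_eq_mul, ← mul_assoc]
          gcongr
          exact card_filter_card_le_le hp m

end DesignRandom

/-! ### A nonasymptotic bound of the selection error -/

section Regularity

variable {n p m : ℕ} {x : Fin n → EuclideanSpace ℝ (Fin p)} {y : Fin n → ℝ}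
  {β : EuclideanSpace ℝ (Fin p)} {c C A L : ℝ}

lemma fisherForm_smul (r : ℝ) (v : EuclideanSpace ℝ (Fin p)) :
    fisherForm x β (r • v) = r ^ 2 * fisherForm x β v := by
  simp only [fisherForm, inner_smul_right, Finset.mul_sum]
  exact Finset.sum_congr rfl fun i _ => by ring

lemma logisticScore_eq_sum (v : EuclideanSpace ℝ (Fin p)) :
    logisticScore x y β v = ∑ j, v j * logisticScore x y β (EuclideanSpace.single j 1) := by
  simp only [logisticScore, Finset.mul_sum]
  rw [Finset.sum_comm]
  refine Finset.sum_congr rfl fun i _ => ?_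
  rw [PiLp.inner_apply (x i) v, Finset.mul_sum]
  refine Finset.sum_congr rfl fun j _ => ?_
  rw [EuclideanSpace.inner_single_right]
  simp only [RCLike.inner_apply, conj_trivial]
  ring

/-- In a good design, the Fisher information at a bounded sparse vector is bounded below. -/
lemma fisherForm_ge_of_mem_goodDesign {K B : ℝ} (hK : 0 < K) (hC : 0 ≤ C)
    (hx : x ∈ goodDesign n p m c C A) (hβm : (coeffSupport β).card ≤ m) (hβ : ‖β‖ ≤ B)
    {v : EuclideanSpace ℝ (Fin p)} (hv : (coeffSupport v).card ≤ m) :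
    (1 + Real.exp K)⁻¹ ^ 2 * (c - (C + C * B ^ 3) / K) * n * ‖v‖ ^ 2 ≤ fisherForm x β v := by
  rcases (norm_nonneg v).eq_or_lt with h0 | h0
  · have : v = 0 := norm_eq_zero.1 h0.symm
    simp [this, fisherForm]
  have hu : ‖‖v‖⁻¹ • v‖ = 1 := by
    rw [norm_smul, norm_inv, norm_norm, inv_mul_cancel₀ h0.ne']
  have hum : (coeffSupport (‖v‖⁻¹ • v)).card ≤ m :=
    (Finset.card_le_card (Submodule.smul_mem _ _ (mem_sparseSubmodule_coeffSupport v))).trans hv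
  obtain ⟨h2, h3⟩ := hx.2 _ hum
  rw [hu, one_pow, mul_one] at h2 h3
  have hβ3 : ∑ i, |inner ℝ (x i) β| ^ 3 ≤ C * B ^ 3 * n := by
    refine (hx.2 β hβm).2.trans ?_
    calc C * n * ‖β‖ ^ 3 ≤ C * n * B ^ 3 := by gcongr
      _ = C * B ^ 3 * n := by ring
  have h := fisherForm_ge x β hK (‖v‖⁻¹ • v) hu h2 h3 hβ3
  rw [hu, fisherForm_smul] at h
  have h4 := mul_le_mul_of_nonneg_right h (sq_nonneg ‖v‖)
  have e : ‖v‖⁻¹ ^ 2 * fisherForm x β v * ‖v‖ ^ 2 = fisherForm x β v := by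
    field_simp
  rw [e] at h4
  linarith

lemma abs_logisticScore_le_of_coord_le (hL : 0 ≤ L)
    (h : ∀ j, |logisticScore x y β (EuclideanSpace.single j 1)| ≤ L)
    {v : EuclideanSpace ℝ (Fin p)} (hv : (coeffSupport v).card ≤ m) :
    |logisticScore x y β v| ≤ L * √m * ‖v‖ := by
  rw [logisticScore_eq_sum]
  calc _ ≤ ∑ j, |v j| * L := by
        refine (Finset.abs_sum_le_sum_abs _ _).trans (Finset.sum_le_sum fun j _ => ?_)
        rw [abs_mul]
        exact mul_le_mul_of_nonneg_left (h j) (abs_nonneg _)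
    _ = L * ∑ j, |v j| := by rw [← Finset.sum_mul, mul_comm]
    _ ≤ L * (√m * ‖v‖) := by
        have h1 := sum_abs_le_of_mem_sparseSubmodule (mem_sparseSubmodule_coeffSupport v)
        have h2 : √(coeffSupport v).card * ‖v‖ ≤ √m * ‖v‖ := by gcongr
        exact mul_le_mul_of_nonneg_left (h1.trans h2) hL
    _ = _ := by ring

end Regularity

/-- A union bound over overfitting models: the sets `J \ J₀` of superfluous indices are distinct
and nonempty, so that the sum is at most `(1 + z) ^ p - 1`. -/
lemma sum_superset_pow_card_sdiff_le {p : ℕ} (J₀ : Finset (Fin p)) {z : ℝ} (hz : 0 ≤ z)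
    (𝒥 : Finset (Finset (Fin p))) (h𝒥 : ∀ J ∈ 𝒥, J₀ ⊆ J ∧ J ≠ J₀) :
    ∑ J ∈ 𝒥, z ^ (J \ J₀).card ≤ Real.exp (p * z) - 1 := by
  classical
  have hinj : Set.InjOn (fun J : Finset (Fin p) => J \ J₀) 𝒥 := by
    intro I hI J hJ hIJ
    rw [← Finset.sdiff_union_of_subset (h𝒥 I hI).1, ← Finset.sdiff_union_of_subset (h𝒥 J hJ).1]
    exact congrArg (· ∪ J₀) hIJ
  have h1 : ∑ J ∈ 𝒥, z ^ (J \ J₀).card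
      ≤ ∑ D ∈ (Finset.univ : Finset (Finset (Fin p))).erase ∅, z ^ D.card := by
    rw [← Finset.sum_image (f := fun D : Finset (Fin p) => z ^ D.card) hinj]
    refine Finset.sum_le_sum_of_subset_of_nonneg ?_ fun _ _ _ => by positivity
    intro D hD
    obtain ⟨J, hJ, rfl⟩ := Finset.mem_image.1 hD
    refine Finset.mem_erase.2 ⟨?_, Finset.mem_univ _⟩
    intro h
    exact (h𝒥 J hJ).2 (Finset.Subset.antisymm (Finset.sdiff_eq_empty_iff_subset.1 h) (h𝒥 J hJ).1)
  have h2 := Finset.sum_erase_add Finset.univ (fun D : Finset (Fin p) => z ^ D.card)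
    (Finset.mem_univ ∅)
  rw [sum_pow_card_eq, Finset.card_empty, pow_zero] at h2
  have := one_add_pow_le_exp_mul hz p
  linarith

section Selection

variable {Ω : Type*} [MeasurableSpace Ω] {μ : Measure Ω} [IsProbabilityMeasure μ] {n p q : ℕ}
  {X : Fin n → Ω → EuclideanSpace ℝ (Fin p)} {Y : Fin n → Ω → ℝ}
  {β₀ : EuclideanSpace ℝ (Fin p)}

/-- The tail bound for one overfitting model, with the third-order term absorbed. -/
lemma condResponseProb_supQuadLogRatio_le_pow {x : Fin n → EuclideanSpace ℝ (Fin p)}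
    {β : EuclideanSpace ℝ (Fin p)} {J₀ J : Finset (Fin p)} (hJ : J₀ ⊆ J) (hJq : J.card ≤ q)
    {c C η T : ℝ} (hc : 0 < c) (hC : 0 ≤ C) (hη₀ : 0 < η) (hη₁ : η < 1) (hT : 0 ≤ T) (hn : 0 < n)
    (hF : ∀ v ∈ sparseSubmodule J, c * n * ‖v‖ ^ 2 ≤ fisherForm x β v)
    (h3 : ∀ v ∈ sparseSubmodule J, ∑ i, |inner ℝ (x i) v| ^ 3 ≤ C * n * ‖v‖ ^ 3)
    (hsmall : C * n * √(2 * (T * q)) / √(c * n) ^ 3 ≤ η / 2) :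
    condResponseProb x β {b | supQuadLogRatio x β (boolResponse b) J₀
        + ENNReal.ofReal (T * (J \ J₀).card) < supQuadLogRatio x β (boolResponse b) J}
      ≤ ((1 + 2 / η) * Real.exp (-((1 - η) ^ 3 * T))) ^ (J \ J₀).card := by
  have hn' : (0 : ℝ) < n := by exact_mod_cast hn
  set k := (J \ J₀).card with hk
  have hkq : (k : ℝ) ≤ q := by
    exact_mod_cast (Finset.card_le_card Finset.sdiff_subset).trans hJq
  refine (condResponseProb_supQuadLogRatio_le x β hJ hc hC hη₀ hη₁ (T := T * k)
    (by positivity) hn hF h3).trans ?_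
  rw [mul_pow (1 + 2 / η), ← Real.exp_nat_mul]
  gcongr
  set l := (1 - η) * √(2 * (T * k)) with hl
  have hl0 : 0 ≤ l := mul_nonneg (by linarith) (Real.sqrt_nonneg _)
  have hlq : l ≤ √(2 * (T * q)) := by
    rw [hl]
    refine (mul_le_of_le_one_left (Real.sqrt_nonneg _) (by linarith)).trans ?_
    gcongr
  have hl2 : l ^ 2 = (1 - η) ^ 2 * (2 * (T * k)) := by
    rw [hl, mul_pow, Real.sq_sqrt (by positivity)]
  have h1 : C * n * (l / √(c * n)) ^ 3 ≤ η / 2 * l ^ 2 := by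
    calc C * n * (l / √(c * n)) ^ 3 = (C * n * l / √(c * n) ^ 3) * l ^ 2 := by
          rw [div_pow]
          ring
      _ ≤ (C * n * √(2 * (T * q)) / √(c * n) ^ 3) * l ^ 2 := by gcongr
      _ ≤ η / 2 * l ^ 2 := by gcongr
  have e : (k : ℝ) * -((1 - η) ^ 3 * T) = η / 2 * l ^ 2 - l ^ 2 / 2 := by
    rw [hl2]
    ring
  rw [e]
  linarith

/-- The probability of a selection error is at most the sum of the probabilities that the design
is not good, that a coordinate of the score is large, and that some overfitting model has a large
quadratic likelihood ratio. -/
lemma IsLogisticSample.measure_not_isBICArgmin_le (h : IsLogisticSample μ X Y β₀) (hn : 0 < n)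
    {c₁ c C A L : ℝ} (hc : 0 < c) (hC : 0 ≤ C) (hA : 0 < A) (hL : 0 ≤ L)
    (hF : ∀ x ∈ goodDesign n p (2 * q) c₁ C A, ∀ v, (coeffSupport v).card ≤ 2 * q →
      c * n * ‖v‖ ^ 2 ≤ fisherForm x β₀ v)
    {ρ : ℝ} (hρ : 0 < ρ) (hr : 4 * C * ρ ≤ c) (hΛ : 8 * (L * √(2 * q : ℕ)) ≤ c * n * ρ)
    (hβ : ∀ j ∈ coeffSupport β₀, ρ ≤ |β₀ j|) (hq : (coeffSupport β₀).card ≤ q)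
    {γ T η : ℝ} (hT : 0 ≤ T) (hη₀ : 0 < η) (hη₁ : η < 1)
    (hsmall : C * n * √(2 * (T * q)) / √(c * n) ^ 3 ≤ η / 2)
    (hpen : q * (Real.log n + 2 * γ * Real.log p) < c * n * ρ ^ 2 / 4)
    (hTpen : 2 * C * n * (4 * (L * √(2 * q : ℕ)) / (c * n)) ^ 3 + T
      < (Real.log n + 2 * γ * Real.log p) / 2) :
    μ {ω | ¬ IsBICArgmin γ q (fun i => X i ω) (fun i => Y i ω) (coeffSupport β₀)}
      ≤ μ {ω | (fun i => X i ω) ∉ goodDesign n p (2 * q) c₁ C A}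
        + ENNReal.ofReal (2 * p * Real.exp (-(L ^ 2 / (4 * n * A ^ 2))))
        + ENNReal.ofReal
          (Real.exp (p * ((1 + 2 / η) * Real.exp (-((1 - η) ^ 3 * T)))) - 1) := by
  classical
  set J₀ := coeffSupport β₀ with hJ₀
  set G := goodDesign n p (2 * q) c₁ C A with hG
  have hGm : MeasurableSet G := (isClosed_goodDesign _ _ _ _ _ _).measurableSet
  set z := (1 + 2 / η) * Real.exp (-((1 - η) ^ 3 * T)) with hz
  have hz0 : 0 ≤ z := by positivity
  set 𝒥 := Finset.univ.filter fun J : Finset (Fin p) => (J₀ ⊆ J ∧ J ≠ J₀) ∧ J.card ≤ q with h𝒥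
  set S1 : (Fin n → EuclideanSpace ℝ (Fin p)) → Set (Fin n → Bool) := fun x =>
    {b | ∃ j, L < |logisticScore x (boolResponse b) β₀ (EuclideanSpace.single j 1)|} with hS1
  set S2 : Finset (Fin p) → (Fin n → EuclideanSpace ℝ (Fin p)) → Set (Fin n → Bool) := fun J x =>
    {b | supQuadLogRatio x β₀ (boolResponse b) J₀ + ENNReal.ofReal (T * (J \ J₀).card)
      < supQuadLogRatio x β₀ (boolResponse b) J} with hS2
  have hcover : {ω | ¬ IsBICArgmin γ q (fun i => X i ω) (fun i => Y i ω) J₀}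
      ⊆ ({ω | (fun i => X i ω) ∉ G} ∪ {ω | (fun i => X i ω) ∈ G ∧
          ∃ b ∈ S1 (fun i => X i ω), (fun i => Y i ω) = boolResponse b})
        ∪ ⋃ J ∈ 𝒥, {ω | (fun i => X i ω) ∈ G ∧
          ∃ b ∈ S2 J (fun i => X i ω), (fun i => Y i ω) = boolResponse b} := by
    intro ω hω
    by_contra hcon
    rw [Set.mem_union, Set.mem_union, not_or, not_or] at hcon
    obtain ⟨⟨hXG, h1⟩, h2⟩ := hcon
    rw [Set.mem_ofPred_eq, not_not] at hXG
    obtain ⟨b, hb⟩ := h.exists_boolResponse ω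
    have hscore : ∀ j, |logisticScore (fun i => X i ω) (fun i => Y i ω) β₀
        (EuclideanSpace.single j 1)| ≤ L := by
      intro j
      by_contra! hlt
      rw [hb] at hlt
      exact h1 ⟨hXG, b, ⟨j, hlt⟩, hb⟩
    have hreg : IsRegularAt (fun i => X i ω) (fun i => Y i ω) β₀ (2 * q) c C
        (L * √(2 * q : ℕ)) :=
      ⟨hF _ hXG, fun v hv => (hXG.2 v hv).2,
        fun v hv => abs_logisticScore_le_of_coord_le hL hscore hv⟩
    refine hω (hreg.isBICArgmin hn hc hC (by positivity) hρ hr hΛ hβ hq hT hpen hTpen ?_)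
    intro J hJ hJq
    by_cases hne : J = J₀
    · rw [hne]
      exact le_self_add
    by_contra! hlt
    rw [hb] at hlt
    exact h2 (Set.mem_biUnion (Finset.mem_filter.2 ⟨Finset.mem_univ _, ⟨hJ, hne⟩, hJq⟩)
      ⟨hXG, b, hlt, hb⟩)
  have hP1 : μ {ω | (fun i => X i ω) ∈ G ∧
      ∃ b ∈ S1 (fun i => X i ω), (fun i => Y i ω) = boolResponse b}
      ≤ ENNReal.ofReal (2 * p * Real.exp (-(L ^ 2 / (4 * n * A ^ 2)))) := by
    refine h.measure_le_of_condResponseProb_le hGm (fun b => ?_)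
      fun x hx => condResponseProb_score_coord_le x β₀ hn hA hx.1 hL
    have e : {x : Fin n → EuclideanSpace ℝ (Fin p) | b ∈ S1 x}
        = ⋃ j, {x | L < |logisticScore x (boolResponse b) β₀ (EuclideanSpace.single j 1)|} := by
      ext x
      simp [hS1]
    rw [e]
    exact (isOpen_iUnion fun j => isOpen_lt continuous_const
      (continuous_logisticScore (boolResponse b) β₀ _).abs).measurableSet
  have hP2 : ∀ J ∈ 𝒥, μ {ω | (fun i => X i ω) ∈ G ∧
      ∃ b ∈ S2 J (fun i => X i ω), (fun i => Y i ω) = boolResponse b}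
      ≤ ENNReal.ofReal (z ^ (J \ J₀).card) := by
    intro J hJ
    obtain ⟨-, ⟨hJJ, -⟩, hJq⟩ := Finset.mem_filter.1 hJ
    refine h.measure_le_of_condResponseProb_le hGm (fun b => ?_) fun x hx => ?_
    · exact measurableSet_lt ((measurable_supQuadLogRatio _ _ _).add_const _)
        (measurable_supQuadLogRatio _ _ _)
    · have hcard : ∀ v ∈ sparseSubmodule J, (coeffSupport v).card ≤ 2 * q := fun v hv =>
        (Finset.card_le_card hv).trans (hJq.trans (by omega))
      exact condResponseProb_supQuadLogRatio_le_pow hJJ hJq hc hC hη₀ hη₁ hT hn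
        (fun v hv => hF x hx v (hcard v hv)) (fun v hv => (hx.2 v (hcard v hv)).2) hsmall
  refine (measure_mono hcover).trans ((measure_union_le _ _).trans (add_le_add
    ((measure_union_le _ _).trans (add_le_add le_rfl hP1)) ?_))
  refine (measure_biUnion_finset_le _ _).trans ((Finset.sum_le_sum hP2).trans ?_)
  rw [← ENNReal.ofReal_sum_of_nonneg fun _ _ => by positivity]
  exact ENNReal.ofReal_le_ofReal (sum_superset_pow_card_sdiff_le J₀ hz0 𝒥
    fun J hJ => (Finset.mem_filter.1 hJ).2.1)

end Selection

/-! ### Asymptotics -/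

lemma eventually_mul_rpow_le (K : ℝ) {a b δ : ℝ} (hab : a < b) (hδ : 0 < δ) :
    ∀ᶠ n : ℕ in atTop, K * (n : ℝ) ^ a ≤ δ * (n : ℝ) ^ b := by
  have h := ((tendsto_rpow_atTop (sub_pos.2 hab)).comp
    tendsto_natCast_atTop_atTop).eventually_ge_atTop (K / δ)
  filter_upwards [h, eventually_gt_atTop 0] with n hn hn0
  have hn0' : (0 : ℝ) < n := by exact_mod_cast hn0
  simp only [Function.comp_apply] at hn
  rw [div_le_iff₀ hδ] at hn
  calc K * (n : ℝ) ^ a ≤ ((n : ℝ) ^ (b - a) * δ) * (n : ℝ) ^ a := by gcongr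
    _ = δ * ((n : ℝ) ^ (b - a) * (n : ℝ) ^ a) := by ring
    _ = δ * (n : ℝ) ^ b := by rw [← Real.rpow_add hn0', sub_add_cancel]

lemma sqrt_rpow {x : ℝ} (hx : 0 ≤ x) (a : ℝ) : √(x ^ a) = x ^ (a / 2) := by
  rw [Real.sqrt_eq_rpow, ← Real.rpow_mul hx]
  ring_nf

section Rates

variable {p q : ℕ → ℕ} {κ : ℝ≥0∞} {τ ψ φ γ : ℝ}

/-- The lower bound of `γ` makes the penalty per index exceed `2 * log p` by a constant factor. -/
lemma exists_penalty_ge (hp : Tendsto p atTop atTop) (hκ : 0 < κ)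
    (hpκ : κ ≠ ⊤ → ∀ᶠ n : ℕ in atTop, (p n : ℝ) ≤ (n : ℝ) ^ κ.toReal)
    (hγ : 1 - ((2 * κ)⁻¹).toReal < γ) :
    ∃ ε : ℝ, 0 < ε ∧ ∀ᶠ n : ℕ in atTop, 2 * ((1 + 2 * ε) * Real.log (p n))
      ≤ Real.log n + 2 * γ * Real.log (p n) := by
  by_cases hk : κ = ⊤
  · have h0 : ((2 * κ)⁻¹).toReal = 0 := by simp [hk, ENNReal.mul_top]
    rw [h0, sub_zero] at hγ
    refine ⟨(γ - 1) / 2, by linarith, ?_⟩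
    filter_upwards with n
    have h1 := Real.log_natCast_nonneg n
    nlinarith
  · have hk0 : 0 < κ.toReal := ENNReal.toReal_pos hκ.ne' hk
    have h0 : ((2 * κ)⁻¹).toReal = (2 * κ.toReal)⁻¹ := by
      rw [ENNReal.toReal_inv, ENNReal.toReal_mul, ENNReal.toReal_ofNat]
    rw [h0] at hγ
    set k := κ.toReal
    refine ⟨(γ - (1 - (2 * k)⁻¹)) / 2, by linarith, ?_⟩
    filter_upwards [hpκ hk, hp.eventually_ge_atTop 1] with n hn hp1
    have hp0 : (0 : ℝ) < p n := by exact_mod_cast hp1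
    have hn0 : (0 : ℝ) < n := by
      rcases Nat.eq_zero_or_pos n with rfl | h
      · rw [Nat.cast_zero, Real.zero_rpow hk0.ne'] at hn
        linarith
      · exact_mod_cast h
    have h1 : Real.log (p n) ≤ k * Real.log n := by
      rw [← Real.log_rpow hn0]
      exact Real.log_le_log hp0 hn
    have h2 : k⁻¹ * Real.log (p n) ≤ Real.log n := by
      rw [inv_mul_le_iff₀ hk0]
      exact h1
    have e : (2 * k)⁻¹ = k⁻¹ / 2 := by rw [mul_inv]; ring
    rw [e]
    nlinarith

lemma natCast_mul_log_le_rpow {n : ℕ} (hn : 0 < n) (hpτ : Real.log (p n) ≤ (n : ℝ) ^ τ)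
    (hqψ : (q n : ℝ) ≤ (n : ℝ) ^ ψ) :
    (q n : ℝ) * Real.log (p n) ≤ (n : ℝ) ^ (ψ + τ) := by
  have hn' : (0 : ℝ) < n := by exact_mod_cast hn
  rw [Real.rpow_add hn']
  exact mul_le_mul hqψ hpτ (Real.log_natCast_nonneg _) (by positivity)

/-- A bound of the score in terms of a power of `n`. -/
lemma score_bound_le_rpow {n : ℕ} {A : ℝ} (hA : 0 ≤ A) (hn : 0 < n)
    (hpτ : Real.log (p n) ≤ (n : ℝ) ^ τ) (hqψ : (q n : ℝ) ≤ (n : ℝ) ^ ψ) :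
    √(8 * A ^ 2 * n * Real.log (p n)) * √(2 * q n : ℕ)
      ≤ 4 * A * (n : ℝ) ^ ((1 + (ψ + τ)) / 2) := by
  have hn' : (0 : ℝ) < n := by exact_mod_cast hn
  have hl := Real.log_natCast_nonneg (p n)
  rw [← Real.sqrt_mul (by positivity), ← sqrt_rpow hn'.le]
  have e : 8 * A ^ 2 * n * Real.log (p n) * ((2 * q n : ℕ) : ℝ)
      = (4 * A) ^ 2 * (n * (q n * Real.log (p n))) := by
    push_cast
    ring
  rw [e, Real.sqrt_mul (by positivity), Real.sqrt_sq (by positivity)]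
  gcongr
  rw [Real.rpow_add hn', Real.rpow_one]
  gcongr
  exact natCast_mul_log_le_rpow hn hpτ hqψ

/-- The score is small compared to the curvature at the distance `n ^ (-φ / 2)`. -/
lemma eventually_score_bound_le (hpτ : ∀ᶠ n : ℕ in atTop, Real.log (p n) ≤ (n : ℝ) ^ τ)
    (hqψ : ∀ᶠ n : ℕ in atTop, (q n : ℝ) ≤ (n : ℝ) ^ ψ) (hφ : φ < 1 - ψ - τ) {A c r : ℝ}
    (hA : 0 ≤ A) (hc : 0 < c) (hr : 0 < r) :
    ∀ᶠ n : ℕ in atTop, 8 * (√(8 * A ^ 2 * n * Real.log (p n)) * √(2 * q n : ℕ))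
      ≤ c * n * (r * (n : ℝ) ^ (-φ / 2)) := by
  filter_upwards [hpτ, hqψ, eventually_gt_atTop 0,
    eventually_mul_rpow_le (8 * (4 * A)) (a := (1 + (ψ + τ)) / 2) (b := 1 + -φ / 2) (δ := c * r)
      (by linarith) (by positivity)] with n h1 h2 hn h3
  have hn' : (0 : ℝ) < n := by exact_mod_cast hn
  rw [Real.rpow_add hn', Real.rpow_one] at h3
  have := score_bound_le_rpow hA hn h1 h2
  nlinarith

/-- The total penalty is small compared to the loss of likelihood of a model that misses an
index. -/
lemma eventually_penalty_lt (hpτ : ∀ᶠ n : ℕ in atTop, Real.log (p n) ≤ (n : ℝ) ^ τ)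
    (hqψ : ∀ᶠ n : ℕ in atTop, (q n : ℝ) ≤ (n : ℝ) ^ ψ) (hτ : 0 < τ) (hφ : φ < 1 - ψ - τ)
    {c r : ℝ} (hc : 0 < c) (hr : 0 < r) :
    ∀ᶠ n : ℕ in atTop, q n * (Real.log n + 2 * γ * Real.log (p n))
      < c * n * (r * (n : ℝ) ^ (-φ / 2)) ^ 2 / 4 := by
  have hlog : ∀ᶠ n : ℕ in atTop, Real.log n ≤ (n : ℝ) ^ τ := by
    have := (isLittleO_log_rpow_atTop hτ).bound one_pos
    filter_upwards [tendsto_natCast_atTop_atTop.eventually this] with n hn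
    have h0 : (0 : ℝ) ≤ (n : ℝ) ^ τ := by positivity
    rw [one_mul, Real.norm_of_nonneg h0] at hn
    exact (le_abs_self _).trans hn
  filter_upwards [hpτ, hqψ, hlog, eventually_gt_atTop 0,
    eventually_mul_rpow_le (2 + 2 * |γ|) (a := ψ + τ) (b := 1 + -φ) (δ := c * r ^ 2 / 4)
      (by linarith) (by positivity)] with n h1 h2 h3 hn h4
  have hn' : (0 : ℝ) < n := by exact_mod_cast hn
  have hl := Real.log_natCast_nonneg (p n)
  have h5 : Real.log n + 2 * γ * Real.log (p n) ≤ (1 + 2 * |γ|) * (n : ℝ) ^ τ := by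
    have : γ * Real.log (p n) ≤ |γ| * (n : ℝ) ^ τ :=
      mul_le_mul (le_abs_self γ) h1 hl (abs_nonneg _)
    linarith
  have h6 : (q n : ℝ) * (Real.log n + 2 * γ * Real.log (p n))
      ≤ (n : ℝ) ^ ψ * ((1 + 2 * |γ|) * (n : ℝ) ^ τ) :=
    (mul_le_mul_of_nonneg_left h5 (Nat.cast_nonneg _)).trans (by gcongr)
  have e : ((n : ℝ) ^ (-φ / 2)) ^ 2 = (n : ℝ) ^ (-φ) := by
    rw [← Real.rpow_natCast, ← Real.rpow_mul hn'.le]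
    norm_num
  rw [Real.rpow_add hn', Real.rpow_add hn', Real.rpow_one] at h4
  rw [mul_pow, e]
  have h7 : 0 < (n : ℝ) ^ ψ * (n : ℝ) ^ τ := by positivity
  calc _ ≤ _ := h6
    _ < (2 + 2 * |γ|) * ((n : ℝ) ^ ψ * (n : ℝ) ^ τ) := by nlinarith
    _ ≤ _ := h4
    _ = _ := by ring

/-- The third-order terms of the log-likelihood are negligible compared to `log p`; this is the
place where `3 * ψ + τ < 1` is needed. -/
lemma eventually_remainder_le (hpτ : ∀ᶠ n : ℕ in atTop, Real.log (p n) ≤ (n : ℝ) ^ τ)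
    (hqψ : ∀ᶠ n : ℕ in atTop, (q n : ℝ) ≤ (n : ℝ) ^ ψ) (hψ₁ : ψ < (1 - τ) / 3) {A c C ε : ℝ}
    (hA : 0 ≤ A) (hc : 0 < c) (hC : 0 ≤ C) (hε : 0 < ε) :
    ∀ᶠ n : ℕ in atTop,
      2 * C * n * (4 * (√(8 * A ^ 2 * n * Real.log (p n)) * √(2 * q n : ℕ)) / (c * n)) ^ 3
        ≤ ε * Real.log (p n) := by
  filter_upwards [hpτ, hqψ, eventually_gt_atTop 0,
    eventually_mul_rpow_le (2 * C * (16 * A) ^ 3 / c ^ 3) (a := ψ + (1 + (ψ + τ)) / 2) (b := 1)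
      (δ := ε) (by linarith) hε] with n h1 h2 hn h3
  have hn' : (0 : ℝ) < n := by exact_mod_cast hn
  have hl := Real.log_natCast_nonneg (p n)
  set s := √(n * (q n * Real.log (p n))) with hs
  have hs2 : s ^ 2 = n * (q n * Real.log (p n)) := Real.sq_sqrt (by positivity)
  have e : √(8 * A ^ 2 * n * Real.log (p n)) * √(2 * q n : ℕ) = 4 * A * s := by
    rw [← Real.sqrt_mul (by positivity)]
    have e : 8 * A ^ 2 * n * Real.log (p n) * ((2 * q n : ℕ) : ℝ)
        = (4 * A) ^ 2 * (n * (q n * Real.log (p n))) := by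
      push_cast
      ring
    rw [e, Real.sqrt_mul (by positivity), Real.sqrt_sq (by positivity)]
  have hsn : s ≤ (n : ℝ) ^ ((1 + (ψ + τ)) / 2) := by
    rw [hs, ← sqrt_rpow hn'.le, Real.rpow_add hn', Real.rpow_one]
    gcongr
    exact natCast_mul_log_le_rpow hn h1 h2
  have hqs : q n * s ≤ (n : ℝ) ^ (ψ + (1 + (ψ + τ)) / 2) := by
    rw [Real.rpow_add hn']
    exact mul_le_mul h2 hsn (Real.sqrt_nonneg _) (by positivity)
  rw [Real.rpow_one] at h3
  rw [e]
  calc 2 * C * n * (4 * (4 * A * s) / (c * n)) ^ 3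
      = 2 * C * (16 * A) ^ 3 / c ^ 3 * (s ^ 2 * s / n ^ 2) := by
        field_simp
        ring
    _ = 2 * C * (16 * A) ^ 3 / c ^ 3 * (q n * s) * (Real.log (p n) / n) := by
        rw [hs2]
        field_simp
    _ ≤ 2 * C * (16 * A) ^ 3 / c ^ 3 * (n : ℝ) ^ (ψ + (1 + (ψ + τ)) / 2)
          * (Real.log (p n) / n) := by gcongr
    _ ≤ ε * n * (Real.log (p n) / n) := by gcongr
    _ = ε * Real.log (p n) := by field_simp

/-- The relative error of the moment generating function of the score at the Chernoff exponents
of overfitting models of size at most `q` vanishes. -/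
lemma eventually_chernoff_remainder_le (hpτ : ∀ᶠ n : ℕ in atTop, Real.log (p n) ≤ (n : ℝ) ^ τ)
    (hqψ : ∀ᶠ n : ℕ in atTop, (q n : ℝ) ≤ (n : ℝ) ^ ψ) (hψτ : ψ + τ < 1) {c C B δ : ℝ}
    (hc : 0 < c) (hC : 0 ≤ C) (hB : 0 ≤ B) (hδ : 0 < δ) :
    ∀ᶠ n : ℕ in atTop,
      C * n * √(2 * (B * Real.log (p n) * q n)) / √(c * n) ^ 3 ≤ δ := by
  filter_upwards [hpτ, hqψ, eventually_gt_atTop 0,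
    eventually_mul_rpow_le (C * √(2 * B) / √c ^ 3) (a := (ψ + τ) / 2) (b := 1 / 2)
      (δ := δ) (by linarith) hδ] with n h1 h2 hn h3
  have hn' : (0 : ℝ) < n := by exact_mod_cast hn
  have hl := Real.log_natCast_nonneg (p n)
  have h4 : √(2 * (B * Real.log (p n) * q n)) ≤ √(2 * B) * (n : ℝ) ^ ((ψ + τ) / 2) := by
    rw [← sqrt_rpow hn'.le, ← Real.sqrt_mul (by positivity)]
    apply Real.sqrt_le_sqrt
    have := natCast_mul_log_le_rpow hn h1 h2
    calc 2 * (B * Real.log (p n) * q n) = 2 * B * (q n * Real.log (p n)) := by ring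
      _ ≤ _ := by gcongr
  rw [← Real.sqrt_eq_rpow] at h3
  have hsn : 0 < √(n : ℝ) := Real.sqrt_pos.2 hn'
  have hsc : 0 < √c := Real.sqrt_pos.2 hc
  have hn2 : (n : ℝ) = √(n : ℝ) ^ 2 := (Real.sq_sqrt hn'.le).symm
  rw [Real.sqrt_mul hc.le]
  calc C * n * √(2 * (B * Real.log (p n) * q n)) / (√c * √n) ^ 3
      ≤ C * n * (√(2 * B) * (n : ℝ) ^ ((ψ + τ) / 2)) / (√c * √n) ^ 3 := by gcongr
    _ = (C * √(2 * B) / √c ^ 3 * (n : ℝ) ^ ((ψ + τ) / 2)) * (n / √n ^ 3) := by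
        field_simp
    _ ≤ (δ * √n) * (n / √n ^ 3) := by gcongr
    _ = δ := by
        rw [mul_assoc, mul_div_assoc', pow_succ, ← hn2, mul_comm (√(n : ℝ)), div_self
          (by positivity), mul_one]

lemma tendsto_exp_sub_rpow (hτ : 0 < τ) (C : ℝ) :
    Tendsto (fun n : ℕ => Real.exp (C - (n : ℝ) ^ τ)) atTop (𝓝 0) := by
  refine Real.tendsto_exp_atBot.comp ?_
  refine tendsto_atBot_add_const_left _ C ?_
  exact tendsto_neg_atTop_atBot.comp ((tendsto_rpow_atTop hτ).comp tendsto_natCast_atTop_atTop)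

lemma tendsto_second_moment_tail (hp : Tendsto p atTop atTop)
    (hpτ : ∀ᶠ n : ℕ in atTop, Real.log (p n) ≤ (n : ℝ) ^ τ)
    (hq₁ : ∀ᶠ n : ℕ in atTop, 1 ≤ q n)
    (hqψ : ∀ᶠ n : ℕ in atTop, (q n : ℝ) ≤ (n : ℝ) ^ ψ) (hτ : 0 < τ) (hψτ : τ + 2 * ψ < 1)
    {a A : ℝ} (ha : 0 < a) (hA : 0 < A) :
    Tendsto (fun n : ℕ => 2 * (p n : ℝ) ^ 2 * Real.exp
      (-((n * (a / (2 * (2 * q n : ℕ)))) ^ 2 / (2 * n * (A * A) ^ 2)))) atTop (𝓝 0) := by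
  have hlim := (tendsto_exp_sub_rpow hτ 0).const_mul 2
  rw [mul_zero] at hlim
  refine squeeze_zero' (Eventually.of_forall fun n => by positivity) ?_ hlim
  filter_upwards [hpτ, hqψ, hq₁, hp.eventually_ge_atTop 1, eventually_gt_atTop 0,
    eventually_mul_rpow_le 3 (a := τ + 2 * ψ) (b := 1) (δ := a ^ 2 / (32 * A ^ 4))
      hψτ (by positivity)] with n h1 h2 hq hp1 hn h3
  have hn' : (0 : ℝ) < n := by exact_mod_cast hn
  have hp0 : (0 : ℝ) < p n := by exact_mod_cast hp1
  have hq0 : (0 : ℝ) < q n := by exact_mod_cast hq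
  rw [Real.rpow_one, Real.rpow_add hn', two_mul ψ, Real.rpow_add hn'] at h3
  have h4 : 3 * (n : ℝ) ^ τ ≤ a ^ 2 / (32 * A ^ 4) * n / q n ^ 2 := by
    rw [le_div_iff₀ (by positivity)]
    refine le_trans ?_ h3
    rw [mul_assoc, pow_two]
    gcongr
  have e1 : (p n : ℝ) ^ 2 = Real.exp (2 * Real.log (p n)) := by
    rw [two_mul, Real.exp_add, Real.exp_log hp0, pow_two]
  have e2 : (n * (a / (2 * (2 * q n : ℕ)))) ^ 2 / (2 * n * (A * A) ^ 2)
      = a ^ 2 / (32 * A ^ 4) * n / q n ^ 2 := by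
    push_cast
    field_simp
    ring
  rw [e1, e2, mul_assoc, ← Real.exp_add]
  gcongr
  linarith

/-- The nets have at most `exp (2 * m * √m)` points for each of the `O (p ^ m)` models of size
`m = 2 * q`; with Chernoff exponents of order `n / m ^ (3 / 2)`, the union bound vanishes since
`3 * ψ + τ < 1`. -/
lemma tendsto_third_moment_tail (hp : Tendsto p atTop atTop)
    (hpτ : ∀ᶠ n : ℕ in atTop, Real.log (p n) ≤ (n : ℝ) ^ τ)
    (hq₁ : ∀ᶠ n : ℕ in atTop, 1 ≤ q n)
    (hqψ : ∀ᶠ n : ℕ in atTop, (q n : ℝ) ≤ (n : ℝ) ^ ψ) (hτ : 0 < τ) (hψ₀ : 0 ≤ ψ)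
    (hψ₁ : ψ < (1 - τ) / 3) {a A : ℝ} (ha : 0 < a) (hA : 0 < A) :
    Tendsto (fun n : ℕ => Real.exp 1 * (p n : ℝ) ^ (2 * q n) * (1 + 2 * √(2 * q n : ℕ)) ^ (2 * q n)
      * Real.exp (-(n * a / (A * √(2 * q n : ℕ)) ^ 3))) atTop (𝓝 0) := by
  refine squeeze_zero' (Eventually.of_forall fun n => by positivity) ?_ (tendsto_exp_sub_rpow hτ 1)
  set B := (A * √2) ^ 3 with hB
  have hB0 : 0 < B := by positivity
  filter_upwards [hpτ, hqψ, hq₁, hp.eventually_ge_atTop 1, eventually_gt_atTop 0,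
    eventually_mul_rpow_le 2 (a := ψ + τ) (b := 1 - 3 * ψ / 2) (δ := a / B / 3)
      (by linarith) (by positivity),
    eventually_mul_rpow_le (4 * √2) (a := 3 * ψ / 2) (b := 1 - 3 * ψ / 2) (δ := a / B / 3)
      (by linarith) (by positivity),
    eventually_mul_rpow_le 1 (a := τ) (b := 1 - 3 * ψ / 2) (δ := a / B / 3)
      (by linarith) (by positivity)] with n h1 h2 hq hp1 hn h3 h4 h5
  have hn' : (0 : ℝ) < n := by exact_mod_cast hn
  have hp0 : (0 : ℝ) < p n := by exact_mod_cast hp1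
  have hq0 : (0 : ℝ) < q n := by exact_mod_cast hq
  have hsq : √(q n : ℝ) ≤ (n : ℝ) ^ (ψ / 2) := by
    rw [← sqrt_rpow hn'.le]
    gcongr
  have es : √((2 * q n : ℕ) : ℝ) = √2 * √(q n : ℝ) := by
    push_cast
    rw [Real.sqrt_mul (by norm_num)]
  have hq32 : (q n : ℝ) * √(q n : ℝ) ≤ (n : ℝ) ^ (3 * ψ / 2) := by
    rw [show 3 * ψ / 2 = ψ + ψ / 2 by ring, Real.rpow_add hn']
    gcongr
  have e1 : (p n : ℝ) ^ (2 * q n) = Real.exp (2 * (q n * Real.log (p n))) := by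
    rw [← Real.exp_log (pow_pos hp0 _), Real.log_pow]
    push_cast
    ring_nf
  have e2 : (1 + 2 * √((2 * q n : ℕ) : ℝ)) ^ (2 * q n)
      ≤ Real.exp (4 * √2 * (q n * √(q n : ℝ))) := by
    refine (one_add_pow_le_exp_mul (by positivity) _).trans (le_of_eq ?_)
    rw [es]
    push_cast
    ring_nf
  have e3 : a / B * (n : ℝ) ^ (1 - 3 * ψ / 2) ≤ n * a / (A * √((2 * q n : ℕ) : ℝ)) ^ 3 := by
    have : (A * √((2 * q n : ℕ) : ℝ)) ^ 3 = B * (q n * √(q n : ℝ)) := by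
      rw [es, hB, ← mul_assoc, mul_pow, pow_succ (√(q n : ℝ)), Real.sq_sqrt hq0.le]
    rw [this, Real.rpow_sub hn', Real.rpow_one, div_mul_div_comm, mul_comm a]
    gcongr
  have h6 := natCast_mul_log_le_rpow hn h1 h2
  have h7 : 4 * √2 * (q n * √(q n : ℝ)) ≤ 4 * √2 * (n : ℝ) ^ (3 * ψ / 2) := by gcongr
  calc _ ≤ Real.exp 1 * Real.exp (2 * (q n * Real.log (p n)))
        * Real.exp (4 * √2 * (q n * √(q n : ℝ)))
        * Real.exp (-(n * a / (A * √(2 * q n : ℕ)) ^ 3)) := by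
        rw [e1]
        gcongr
    _ = Real.exp (1 + 2 * (q n * Real.log (p n)) + 4 * √2 * (q n * √(q n : ℝ))
        - n * a / (A * √(2 * q n : ℕ)) ^ 3) := by
        rw [sub_eq_add_neg, Real.exp_add, Real.exp_add, Real.exp_add]
    _ ≤ _ := by
        apply Real.exp_le_exp.2
        linarith

lemma tendsto_log_natCast_comp (hp : Tendsto p atTop atTop) :
    Tendsto (fun n => Real.log (p n)) atTop atTop :=
  Real.tendsto_log_atTop.comp (tendsto_natCast_atTop_atTop.comp hp)

lemma tendsto_score_tail (hp : Tendsto p atTop atTop) {A : ℝ} (hA : 0 < A) :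
    Tendsto (fun n : ℕ => 2 * (p n : ℝ) *
      Real.exp (-(√(8 * A ^ 2 * n * Real.log (p n)) ^ 2 / (4 * n * A ^ 2)))) atTop (𝓝 0) := by
  have hlim : Tendsto (fun n : ℕ => 2 * Real.exp (-Real.log (p n))) atTop (𝓝 (2 * 0)) :=
    (Real.tendsto_exp_atBot.comp
      (tendsto_neg_atTop_atBot.comp (tendsto_log_natCast_comp hp))).const_mul 2
  rw [mul_zero] at hlim
  refine hlim.congr' ?_
  filter_upwards [hp.eventually_ge_atTop 1, eventually_gt_atTop 0] with n hp1 hn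
  have hn' : (0 : ℝ) < n := by exact_mod_cast hn
  have hp0 : (0 : ℝ) < p n := by exact_mod_cast hp1
  have hl := Real.log_natCast_nonneg (p n)
  rw [Real.sq_sqrt (by positivity)]
  have e : 8 * A ^ 2 * n * Real.log (p n) / (4 * n * A ^ 2) = 2 * Real.log (p n) := by
    field_simp
    ring
  have e2 : (p n : ℝ) = Real.exp (Real.log (p n)) := (Real.exp_log hp0).symm
  rw [e, mul_assoc]
  nth_rewrite 2 [e2]
  rw [← Real.exp_add]
  ring_nf

/-- The union bound over all overfitting models, each of which has an upper tail
`(B * p ^ (-η)) ^ k` with `η > 1`. -/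
lemma tendsto_overfit_tail (hp : Tendsto p atTop atTop) {B ε η : ℝ} (hB : 0 ≤ B) (hε : 0 < ε)
    (hη : 1 + ε ≤ η) :
    Tendsto (fun n : ℕ => Real.exp (p n * (B * Real.exp (-(η * Real.log (p n))))) - 1)
      atTop (𝓝 0) := by
  have h1 : Tendsto (fun n : ℕ => B * Real.exp (-(ε * Real.log (p n)))) atTop (𝓝 (B * 0)) :=
    (Real.tendsto_exp_atBot.comp (tendsto_neg_atTop_atBot.comp
      ((tendsto_log_natCast_comp hp).const_mul_atTop hε))).const_mul B
  rw [mul_zero] at h1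
  have h2 : Tendsto (fun n : ℕ => p n * (B * Real.exp (-(η * Real.log (p n))))) atTop (𝓝 0) := by
    refine squeeze_zero' (Eventually.of_forall fun n => by positivity) ?_ h1
    filter_upwards [hp.eventually_ge_atTop 1] with n hp1
    have hp0 : (0 : ℝ) < p n := by exact_mod_cast hp1
    have hl := Real.log_natCast_nonneg (p n)
    calc (p n : ℝ) * (B * Real.exp (-(η * Real.log (p n))))
        = B * (Real.exp (Real.log (p n)) * Real.exp (-(η * Real.log (p n)))) := by
          rw [Real.exp_log hp0]
          ring
      _ ≤ B * Real.exp (-(ε * Real.log (p n))) := by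
          rw [← Real.exp_add]
          gcongr
          nlinarith
  have h3 := (Real.continuous_exp.tendsto 0).comp h2
  rw [Real.exp_zero] at h3
  simpa using h3.sub_const 1

end Rates

/-! ### Consistency of the extended BIC -/

theorem mainTheorem5
    {Ω : ℕ → Type*} [∀ n, MeasurableSpace (Ω n)]
    (μ : ∀ n, Measure (Ω n)) [∀ n, IsProbabilityMeasure (μ n)]
    (p q : ℕ → ℕ)
    (X : ∀ n, Fin n → Ω n → EuclideanSpace ℝ (Fin (p n)))
    (Y : ∀ n, Fin n → Ω n → ℝ)
    (β₀ : ∀ n, EuclideanSpace ℝ (Fin (p n)))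
    (hsample : ∀ n, IsLogisticSample (μ n) (X n) (Y n) (β₀ n))
    (κ : ℝ≥0∞) (τ ψ φ a₀ a₁ a₂ a₃ γ : ℝ)
    (hκ : 0 < κ) (hτ₀ : 0 < τ) (hτ₁ : τ < 1)
    (hψ₀ : 0 ≤ ψ) (hψ₁ : ψ < (1 - τ) / 3)
    (hφ₀ : 0 ≤ φ) (hφ₁ : φ < 1 - ψ - τ)
    (ha₀ : 0 < a₀) (ha₁ : 0 < a₁) (ha₂ : 0 < a₂) (ha₃ : 0 < a₃)
    (hp : Tendsto p atTop atTop)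
    (hpκ : κ ≠ ⊤ → ∀ᶠ n : ℕ in atTop, (p n : ℝ) ≤ (n : ℝ) ^ κ.toReal)
    (hpτ : ∀ᶠ n : ℕ in atTop, Real.log (p n) ≤ (n : ℝ) ^ τ)
    (hq₁ : ∀ᶠ n : ℕ in atTop, 1 ≤ q n)
    (hqψ : ∀ᶠ n : ℕ in atTop, (q n : ℝ) ≤ (n : ℝ) ^ ψ)
    (hβmin : ∀ᶠ n : ℕ in atTop,
      ∀ j ∈ coeffSupport (β₀ n), (n : ℝ) ^ (-φ / 2) ≤ |β₀ n j|)
    (hcov : ∀ᶠ n : ℕ in atTop,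
      ∀ i, CovariateAssumptions (μ n) (X n i) (2 * q n) a₁ a₂ a₃)
    (hJ₀ : ∀ᶠ n : ℕ in atTop, (coeffSupport (β₀ n)).card ≤ q n)
    (hβ₀ : ∀ᶠ n : ℕ in atTop, ‖β₀ n‖ ≤ a₀)
    (hγ : 1 - ((2 * κ)⁻¹).toReal < γ) :
    Tendsto
      (fun n => μ n {ω | IsBICArgmin γ (q n) (fun i => X n i ω) (fun i => Y n i ω)
        (coeffSupport (β₀ n))})
      atTop (𝓝 1) := by
  -- The curvature constant `c` of the log-likelihood, from the truncation level `K`.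
  set C := 4 * (3 * a₂ + a₃ ^ 3) with hCdef
  have hC : 0 < C := by positivity
  set K := 4 * (C + C * a₀ ^ 3) / a₁ with hKdef
  have hK : 0 < K := by positivity
  set c := (1 + Real.exp K)⁻¹ ^ 2 * (a₁ / 2 - (C + C * a₀ ^ 3) / K) with hcdef
  have hc : 0 < c := by
    have e : a₁ / 2 - (C + C * a₀ ^ 3) / K = a₁ / 4 := by
      rw [hKdef]
      field_simp
      ring
    rw [hcdef, e]
    positivity
  -- The radius below which the quadratic approximation is valid.
  set r := min 1 (c / (4 * C)) with hrdef
  have hr : 0 < r := lt_min one_pos (by positivity)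
  obtain ⟨ε, hε, hpen⟩ := exists_penalty_ge hp hκ hpκ hγ
  -- The resolution `η` of the nets is such that `1 + ε / 2 ≤ (1 - η) ^ 3 * (1 + ε)`.
  set η := ε / (6 * (1 + ε)) with hηdef
  have hη₀ : 0 < η := by positivity
  have hη₁ : η < 1 := by
    rw [hηdef, div_lt_one (by positivity)]
    linarith
  have hηε : 1 + ε / 2 ≤ (1 - η) ^ 3 * (1 + ε) := by
    have e : η * (1 + ε) = ε / 6 := by
      rw [hηdef]
      field_simp
    have h3 : 1 - 3 * η ≤ (1 - η) ^ 3 := by nlinarith [sq_nonneg η, mul_nonneg hη₀.le hη₀.le]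
    calc 1 + ε / 2 = (1 - 3 * η) * (1 + ε) := by linarith
      _ ≤ _ := by gcongr
  have hbound : ∀ᶠ n : ℕ in atTop,
      μ n {ω | ¬ IsBICArgmin γ (q n) (fun i => X n i ω) (fun i => Y n i ω) (coeffSupport (β₀ n))}
        ≤ ENNReal.ofReal (2 * (p n : ℝ) ^ 2 * Real.exp
            (-((n * (a₁ / (2 * (2 * q n : ℕ)))) ^ 2 / (2 * n * (a₃ * a₃) ^ 2))))
          + ENNReal.ofReal (Real.exp 1 * (p n : ℝ) ^ (2 * q n)
            * (1 + 2 * √(2 * q n : ℕ)) ^ (2 * q n)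
            * Real.exp (-(n * a₂ / (a₃ * √(2 * q n : ℕ)) ^ 3)))
          + ENNReal.ofReal (2 * (p n : ℝ) * Real.exp
            (-(√(8 * a₃ ^ 2 * n * Real.log (p n)) ^ 2 / (4 * n * a₃ ^ 2))))
          + ENNReal.ofReal (Real.exp (p n * ((1 + 2 / η)
            * Real.exp (-((1 - η) ^ 3 * (1 + ε) * Real.log (p n))))) - 1) := by
    filter_upwards [hpen, hq₁, hβmin, hcov, hJ₀, hβ₀, hp.eventually_ge_atTop 2,
      eventually_gt_atTop 0,
      eventually_score_bound_le hpτ hqψ hφ₁ ha₃.le hc hr,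
      eventually_penalty_lt (γ := γ) hpτ hqψ hτ₀ hφ₁ hc hr,
      eventually_remainder_le hpτ hqψ hψ₁ ha₃.le hc hC.le (half_pos hε),
      eventually_chernoff_remainder_le hpτ hqψ (by linarith) hc hC.le (B := 1 + ε)
        (by linarith) (half_pos hη₀)]
      with n hpen hq hβmin hcov hJ₀ hβ₀ hp2 hn hscore hpenlt hrem hchern
    have hn' : (1 : ℝ) ≤ n := by exact_mod_cast hn
    have hlog : 0 < Real.log (p n) := Real.log_pos (by exact_mod_cast hp2)
    have hρle : r * (n : ℝ) ^ (-φ / 2) ≤ r :=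
      mul_le_of_le_one_right hr.le (Real.rpow_le_one_of_one_le_of_nonpos hn' (by linarith))
    have hindX : iIndepFun (X n) (μ n) :=
      (hsample n).indep.comp (fun _ z => z.1) fun _ => measurable_fst
    have hdesign := measure_notMem_goodDesign_le (hsample n).measurable_covariate hindX hcov ha₁
      ha₂ ha₃ (by omega) (by omega)
    refine ((hsample n).measure_not_isBICArgmin_le hn (c₁ := a₁ / 2) (c := c) (C := C) (A := a₃)
      (L := √(8 * a₃ ^ 2 * n * Real.log (p n))) hc hC.le ha₃ (Real.sqrt_nonneg _)
      (fun x hx v hv => fisherForm_ge_of_mem_goodDesign hK hC.le hx (hJ₀.trans (by omega)) hβ₀ hv)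
      (ρ := r * (n : ℝ) ^ (-φ / 2)) (by positivity) ?_ hscore ?_ hJ₀
      (T := (1 + ε) * Real.log (p n)) (by positivity) hη₀ hη₁ hchern hpenlt ?_).trans ?_
    · calc 4 * C * (r * (n : ℝ) ^ (-φ / 2)) ≤ 4 * C * (c / (4 * C)) := by
            gcongr
            exact hρle.trans (min_le_right _ _)
        _ = c := by field_simp
    · intro j hj
      refine le_trans (mul_le_of_le_one_left (by positivity) (min_le_left _ _)) (hβmin j hj)
    · have : 0 < ε * Real.log (p n) := by positivity
      linarith
    · rw [← mul_assoc ((1 - η) ^ 3)]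
      gcongr
  have hlim : Tendsto (fun n =>
      μ n {ω | ¬ IsBICArgmin γ (q n) (fun i => X n i ω) (fun i => Y n i ω) (coeffSupport (β₀ n))})
      atTop (𝓝 0) := by
    refine tendsto_of_tendsto_of_tendsto_of_le_of_le' tendsto_const_nhds ?_
      (Eventually.of_forall fun _ => zero_le) hbound
    have h1 := ENNReal.tendsto_ofReal
      (tendsto_second_moment_tail hp hpτ hq₁ hqψ hτ₀ (by linarith) ha₁ ha₃)
    have h2 := ENNReal.tendsto_ofReal
      (tendsto_third_moment_tail hp hpτ hq₁ hqψ hτ₀ hψ₀ hψ₁ ha₂ ha₃)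
    have h3 := ENNReal.tendsto_ofReal (tendsto_score_tail hp ha₃)
    have h4 := ENNReal.tendsto_ofReal
      (tendsto_overfit_tail hp (B := 1 + 2 / η) (by positivity) (half_pos hε) hηε)
    simpa using ((h1.add h2).add h3).add h4
  -- The selection event need not be measurable, but outer measures are subadditive.
  have hlow : ∀ n, 1 - μ n {ω | ¬ IsBICArgmin γ (q n) (fun i => X n i ω) (fun i => Y n i ω)
      (coeffSupport (β₀ n))} ≤ μ n {ω | IsBICArgmin γ (q n) (fun i => X n i ω)
      (fun i => Y n i ω) (coeffSupport (β₀ n))} := by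
    intro n
    rw [tsub_le_iff_right, ← measure_univ (μ := μ n)]
    refine le_trans (measure_mono fun ω _ => ?_) (measure_union_le _ _)
    exact em (IsBICArgmin γ (q n) (fun i => X n i ω) (fun i => Y n i ω) (coeffSupport (β₀ n)))
  have hlim' := ENNReal.Tendsto.sub (tendsto_const_nhds (x := (1 : ℝ≥0∞))) hlim
    (Or.inl ENNReal.one_ne_top)
  rw [tsub_zero] at hlim'
  exact tendsto_of_tendsto_of_tendsto_of_le_of_le hlim' tendsto_const_nhds hlow fun n => prob_le_one
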